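/- Let $J$ be a semi-infinite Jacobi matrix with real diagonal entries $b_1,b_2,\dots$ and off-diagonal entries $a_1,a_2,\dots>0$ such that $\limsup_{n\to\infty}(|b_n|+|a_n-1|)^{1/n}<1$, regarded as a bounded self-adjoint operator on $\ell^2(\{1,2,\dots\})$. For $0<|z|<1$ let $(\psi_n(z))_{n\ge 0}$ be the Jost solution, i.e. the unique sequence with (setting $a_0=1$) $$a_{n-1}\psi_{n-1}+b_n\psi_n+a_n\psi_{n+1}=(z+z^{-1})\psi_n\quad(n\ge 1),\qquad \lim_{n\to\infty}z^{-n}\psi_n(z)=1,$$ let $u(z)=\psi_0(z)$ be the Jost function of $J$, and let $M(z)=\langle\delta_1,(z+z^{-1}-J)^{-1}\delta_1\rangle$. Let $J^{(1)}$ be the Jacobi matrix with parameters $\{a_{n+1},b_{n+1}\}_{n\ge1}$ (coefficient stripping), and let $u^{(1)}$ and $M^{(1)}$ be its Jost function and $M$-function. Assume that $u$ has a meromorphic continuation to all of $\mathbb C$, again denoted $u$. A point $z_0$ with $|z_0|<1$ and $u(z_0)=0$ is called a noncanonical zero for $J$ if $1/z_0$ is not a pole of $u$ and $$\lim_{z\to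 z_0}(z-z_0)M(z)\neq (z_0-z_0^{-1})\Bigl[u'(z_0)\,u\Bigl(\frac1{z_0}\Bigr)\Bigr]^{-1},$$ where the right side is regarded as infinite, so that the condition holds, if $u(1/z_0)=0$. Let $P_1(J)$ be the set of poles of $u$ in $\mathbb C$, let $P_2(J)=\{z^{-1} : z \text{ is a noncanonical zero for } J\}$, and let $P(J)=P_1(J)\cup P_2(J)$. Theorem. The Jost function $u^{(1)}$ of $J^{(1)}$ also has a meromorphic continuation to all of $\mathbb C$, and with $P(J^{(1)})$ defined from $J^{(1)}$, $u^{(1)}$ and $M^{(1)}$ in the same way, $$P(J)=P(J^{(1)}).$$ -/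

import Mathlib

open Filter Topology

noncomputable section

/-- The parameters of a bounded semi-infinite Jacobi matrix `J`, with `b_1, b_2, …` on the
diagonal and `a_1, a_2, … > 0` next to it. The index is shifted by one:
`a n` is `a_{n+1}` and `b n` is `b_{n+1}`. -/
structure JacobiMatrix where
  a : ℕ → ℝ
  b : ℕ → ℝ
  a_pos : ∀ n, 0 < a n
  bounded : ∃ K : ℝ, ∀ n, |a n| ≤ K ∧ |b n| ≤ K

namespace JacobiMatrix

/-- Exponential decay: `limsup (|b_n| + |a_n - 1|)^{1/n} < 1`
(the limsup is taken in `[0, ∞]`). -/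
def ExpDecay (J : JacobiMatrix) : Prop :=
  limsup (fun n : ℕ => ENNReal.ofReal (|J.b n| + |J.a n - 1|) ^ (1 / ((n : ℝ) + 1))) atTop < 1

/-- Coefficient stripping: `J^{(1)}` has the Jacobi parameters `a_{n+1}, b_{n+1}`, `n ≥ 1`. -/
def strip (J : JacobiMatrix) : JacobiMatrix where
  a := fun n => J.a (n + 1)
  b := fun n => J.b (n + 1)
  a_pos := fun n => J.a_pos (n + 1)
  bounded := J.bounded.imp fun _ h n => h (n + 1)

/-- The tridiagonal matrix `J` applied to a sequence. -/
def act (J : JacobiMatrix) (v : ℕ → ℂ) : ℕ → ℂ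
  | 0 => J.b 0 * v 0 + J.a 0 * v 1
  | n + 1 => J.a n * v n + J.b (n + 1) * v (n + 1) + J.a (n + 1) * v (n + 2)

/-- The Hilbert space `ℓ²`. -/
abbrev L2 : Type := lp (fun _ : ℕ => ℂ) 2

theorem norm_act_sq_le (J : JacobiMatrix) {K : ℝ} (hK : ∀ n, |J.a n| ≤ K ∧ |J.b n| ≤ K)
    (v : ℕ → ℂ) (n : ℕ) :
    ‖J.act v n‖ ^ 2 ≤
      3 * K ^ 2 * (‖v (n - 1)‖ ^ 2 + ‖v n‖ ^ 2 + ‖v (n + 1)‖ ^ 2) := by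
  have hK0 : 0 ≤ K := (abs_nonneg _).trans (hK 0).1
  have key : ∀ x : ℝ, |x| ≤ K → ∀ w : ℂ, ‖(x : ℂ) * w‖ ≤ K * ‖w‖ := by
    intro x hx w
    rw [norm_mul, Complex.norm_real, Real.norm_eq_abs]
    exact mul_le_mul_of_nonneg_right hx (norm_nonneg _)
  have fin : ∀ N p q r : ℝ, 0 ≤ N → N ≤ K * p + K * q + K * r →
      N ^ 2 ≤ 3 * K ^ 2 * (p ^ 2 + q ^ 2 + r ^ 2) := by
    intro N p q r hN h
    have h1 : N ^ 2 ≤ (K * p + K * q + K * r) ^ 2 := pow_le_pow_left₀ hN h 2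
    nlinarith [sq_nonneg (K * p - K * q), sq_nonneg (K * q - K * r), sq_nonneg (K * p - K * r)]
  cases n with
  | zero =>
    refine fin _ _ _ _ (norm_nonneg _) ?_
    have h := norm_add_le ((J.b 0 : ℂ) * v 0) (J.a 0 * v 1)
    have h0 := mul_nonneg hK0 (norm_nonneg (v (0 - 1)))
    have h1 := key _ (hK 0).2 (v 0)
    have h2 := key _ (hK 0).1 (v 1)
    simp only [act]
    linarith
  | succ n =>
    refine fin _ _ _ _ (norm_nonneg _) ?_
    have h := norm_add₃_le (a := (J.a n : ℂ) * v n) (b := J.b (n + 1) * v (n + 1))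
      (c := J.a (n + 1) * v (n + 2))
    have h0 := key _ (hK n).1 (v n)
    have h1 := key _ (hK (n + 1)).2 (v (n + 1))
    have h2 := key _ (hK (n + 1)).1 (v (n + 2))
    simp only [act, Nat.add_sub_cancel]
    linarith

theorem summable_sq (v : L2) : Summable fun n => ‖v n‖ ^ 2 := by
  have h := (lp.memℓp v).summable (by norm_num)
  simpa using h

theorem summable_three (v : L2) :
    Summable fun n => ‖v (n - 1)‖ ^ 2 + ‖v n‖ ^ 2 + ‖v (n + 1)‖ ^ 2 := by
  have h := summable_sq v
  refine (Summable.add ?_ h).add ((summable_nat_add_iff 1).2 h)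
  exact (summable_nat_add_iff 1).1 (by simpa using h)

theorem memℓp_act (J : JacobiMatrix) (v : L2) : Memℓp (J.act v) 2 := by
  obtain ⟨K, hK⟩ := J.bounded
  refine memℓp_gen ?_
  have := Summable.of_nonneg_of_le (fun n => sq_nonneg ‖J.act v n‖)
    (fun n => J.norm_act_sq_le hK v n) ((summable_three v).mul_left _)
  simpa using this

theorem act_bound (J : JacobiMatrix) :
    ∃ C : ℝ, ∀ v : L2, ‖(⟨J.act v, J.memℓp_act v⟩ : L2)‖ ≤ C * ‖v‖ := by
  obtain ⟨K, hK⟩ := J.bounded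
  have hK0 : 0 ≤ K := (abs_nonneg _).trans (hK 0).1
  refine ⟨4 * K, fun v => ?_⟩
  have hsq : ∀ w : L2, ‖w‖ ^ 2 = ∑' n, ‖w n‖ ^ 2 := by
    intro w
    have h := lp.norm_rpow_eq_tsum (p := 2) (by norm_num) w
    simpa using h
  have hv := summable_sq v
  have hv1 := (summable_nat_add_iff 1).2 hv
  have hvm : Summable fun n => ‖v (n - 1)‖ ^ 2 := (summable_nat_add_iff 1).1 (by simpa using hv)
  have e1 : ∑' n, ‖v (n + 1)‖ ^ 2 = ‖v‖ ^ 2 - ‖v 0‖ ^ 2 := by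
    rw [hsq v, hv.tsum_eq_zero_add]; ring
  have e0 : ∑' n, ‖v (n - 1)‖ ^ 2 = ‖v 0‖ ^ 2 + ‖v‖ ^ 2 := by
    rw [hvm.tsum_eq_zero_add, hsq v]; simp
  refine le_of_sq_le_sq ?_ (by positivity)
  have h := (summable_sq (⟨J.act v, J.memℓp_act v⟩ : L2)).tsum_le_tsum
    (fun n => J.norm_act_sq_le hK v n) ((summable_three v).mul_left (3 * K ^ 2))
  rw [tsum_mul_left, (hvm.add hv).tsum_add hv1, hvm.tsum_add hv, e0, e1, ← hsq v] at h
  have h' := (hsq (⟨J.act v, J.memℓp_act v⟩ : L2)).trans_le h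
  nlinarith [sq_nonneg (K * ‖v‖)]

theorem act_add (J : JacobiMatrix) (v w : ℕ → ℂ) : J.act (v + w) = J.act v + J.act w := by
  funext n
  cases n <;> simp only [act, Pi.add_apply] <;> ring

theorem act_smul (J : JacobiMatrix) (c : ℂ) (v : ℕ → ℂ) : J.act (c • v) = c • J.act v := by
  funext n
  cases n <;> simp only [act, Pi.smul_apply, smul_eq_mul] <;> ring

/-- `J` as a bounded operator on `ℓ²`. -/
def op (J : JacobiMatrix) : L2 →L[ℂ] L2 :=
  LinearMap.mkContinuousOfExistsBound
    { toFun := fun v => ⟨J.act v, J.memℓp_act v⟩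
      map_add' := fun v w => lp.ext (J.act_add v w)
      map_smul' := fun c v => lp.ext (J.act_smul c v) }
    J.act_bound

/-- The first unit vector `δ_1` of `ℓ²`. -/
def delta : L2 := lp.single 2 0 1

/-- The `M`-function `M(z) = ⟨δ_1, (z + z⁻¹ - J)⁻¹ δ_1⟩`, meaningful at those `z ≠ 0` in the
unit disk for which `z + z⁻¹` is not in the spectrum of `J`. -/
def M (J : JacobiMatrix) (z : ℂ) : ℂ :=
  inner ℂ delta (resolvent J.op (z + z⁻¹) delta)

/-- `ψ` is the Jost solution of `J` at `z`: with `a_0 = 1`,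
`a_{n-1} ψ_{n-1} + b_n ψ_n + a_n ψ_{n+1} = (z + z⁻¹) ψ_n` for all `n ≥ 1`, and
`z^{-n} ψ_n → 1`. It is unique for `0 < |z| < 1`. -/
structure IsJostSolution (J : JacobiMatrix) (z : ℂ) (ψ : ℕ → ℂ) : Prop where
  first : ψ 0 + J.b 0 * ψ 1 + J.a 0 * ψ 2 = (z + z⁻¹) * ψ 1
  step : ∀ n, J.a n * ψ (n + 1) + J.b (n + 1) * ψ (n + 2) + J.a (n + 1) * ψ (n + 3) =
    (z + z⁻¹) * ψ (n + 2)
  asymp : Tendsto (fun n => (z ^ n)⁻¹ * ψ n) atTop (𝓝 1)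

/-- The Jost function `u(z) = ψ_0(z)` of `J`, where `ψ(z)` is the Jost solution, is entire
meromorphic, and `u : ℂ → ℂ` is its meromorphic continuation from the punctured disk to `ℂ`.
The value of `u` at each point which is not a pole is the limit there
(`u` is in meromorphic normal form), so that `u` is unique. -/
structure IsEntireMeromorphicJost (J : JacobiMatrix) (u : ℂ → ℂ) : Prop where
  meromorphic : MeromorphicNFOn u Set.univ
  jost : ∀ z : ℂ, 0 < ‖z‖ → ‖z‖ < 1 → ∃ ψ, J.IsJostSolution z ψ ∧ u z = ψ 0

/-- `w` is a pole of `u`. -/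
def IsPole (u : ℂ → ℂ) (w : ℂ) : Prop := meromorphicOrderAt u w < 0

/-- `z₀` is a noncanonical zero for `J`, whose continued Jost function is `u`: `|z₀| < 1`,
`u(z₀) = 0`, `1/z₀` is not a pole of `u`, and
`lim_{z → z₀} (z - z₀) M(z) ≠ (z₀ - z₀⁻¹) [u'(z₀) u(1/z₀)]⁻¹`,
where the right side is infinite, and the inequality true, if `u(1/z₀) = 0`. -/
structure IsNoncanonicalZero (J : JacobiMatrix) (u : ℂ → ℂ) (z₀ : ℂ) : Prop where
  mem_disk : ‖z₀‖ < 1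
  zero : u z₀ = 0
  not_pole : ¬ IsPole u z₀⁻¹
  weight : u z₀⁻¹ = 0 ∨ ∃ L : ℂ, Tendsto (fun z => (z - z₀) * J.M z) (𝓝[≠] z₀) (𝓝 L) ∧
    L ≠ (z₀ - z₀⁻¹) * (deriv u z₀ * u z₀⁻¹)⁻¹

/-- `P₁`: the poles of `u`. -/
def P₁ (u : ℂ → ℂ) : Set ℂ := {w | IsPole u w}

/-- `P₂`: the reciprocals of the noncanonical zeros. -/
def P₂ (J : JacobiMatrix) (u : ℂ → ℂ) : Set ℂ := {w | ∃ z, J.IsNoncanonicalZero u z ∧ w = z⁻¹}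

/-- `P(J) = P₁ ∪ P₂`, where `u` is the continued Jost function of `J`. -/
def P (J : JacobiMatrix) (u : ℂ → ℂ) : Set ℂ := P₁ u ∪ J.P₂ u

end JacobiMatrix

end

/-! Exponential decay makes f_n(z) = z^{-n} ψ_n(z) analytic on a disk of radius R > 1
(`GeometricDecay.exists_isJostFamily`). There u = f_0 and u₁ = a_1 f_1, where u₁ denotes u^{(1)}. On
the annulus 1/R < |z| < R the Wronskian of the solutions at z and 1/z is constant in n. Evaluating
it at n = 0 and at infinity and continuing meromorphically gives p u₁ = c + q u for |t| > 1, with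
p(t) = t f_0(1/t), q(t) = a_1 t^{-1} f_1(1/t) and c(t) = a_1 (t - 1/t). The coefficients are
analytic there, so solving for u₁ continues it to the plane.

Since M = ψ_1/ψ_0, the residue of M at a zero z₀ of u is z₀ f_1(z₀)/f_0'(z₀). Noncanonicity at w =
1/z₀ therefore means that p(w) = 0 while c + q u is analytic and nonzero at w. For J^{(1)} it means
that q(w) = 0 while p u₁ - c is analytic and nonzero at w. If p(w) = 0 and c + q u is nonzero, u₁
must have a pole. If u has a pole and u₁ does not, q must vanish at w, and since its zero is simple,
q u = p u₁ - c cannot vanish too. The relation is symmetric in u and u₁, so the converse is the same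
argument. Simplicity of the zeros comes from self-adjointness. -/

noncomputable section

/-! ### Analytic Jost solutions beyond the unit disk -/

namespace JacobiMatrix

/-- The parameters `b_n` and `a_n - 1` are bounded by a geometric sequence. -/
def GeometricDecay (J : JacobiMatrix) : Prop :=
  ∃ C q : ℝ, 0 < q ∧ q < 1 ∧ ∀ n, |J.b n| ≤ C * q ^ n ∧ |J.a n - 1| ≤ C * q ^ n

theorem ExpDecay.geometricDecay {J : JacobiMatrix} (hJ : J.ExpDecay) : J.GeometricDecay := by
  obtain ⟨q, hq, hq1⟩ := exists_between hJ
  have hqt : q ≠ ⊤ := (hq1.trans ENNReal.one_lt_top).ne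
  have hq0 : 0 < q.toReal := ENNReal.toReal_pos (bot_le.trans_lt hq).ne' hqt
  have hq1' : q.toReal < 1 := by
    simpa using (ENNReal.toReal_lt_toReal hqt ENNReal.one_ne_top).2 hq1
  obtain ⟨N, hN⟩ := eventually_atTop.1 (eventually_lt_of_limsup_lt hq)
  set x : ℕ → ℝ := fun n => |J.b n| + |J.a n - 1| with hx
  have hx0 : ∀ n, 0 ≤ x n := fun n => by positivity
  have hlarge : ∀ n ≥ N, x n ≤ q.toReal ^ n := by
    intro n hn
    have h := hN n hn
    have hpos : (0 : ℝ) < (n : ℝ) + 1 := by positivity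
    have h1 : ENNReal.ofReal (x n) ≤ q ^ (n + 1) := by
      have h2 := ENNReal.rpow_le_rpow h.le hpos.le
      rw [← ENNReal.rpow_mul, one_div_mul_cancel hpos.ne', ENNReal.rpow_one] at h2
      simpa [← ENNReal.rpow_natCast] using h2
    have h2 := ENNReal.toReal_mono (ENNReal.pow_ne_top hqt) h1
    rw [ENNReal.toReal_ofReal (hx0 n), ENNReal.toReal_pow, pow_succ] at h2
    exact h2.trans (mul_le_of_le_one_right (by positivity) hq1'.le)
  -- The sum absorbs the finitely many n < N, where the limsup gives no bound.
  refine ⟨1 + ∑ i ∈ Finset.range N, x i / q.toReal ^ i, q.toReal, hq0, hq1', ?_⟩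
  have key : ∀ n, x n ≤ (1 + ∑ i ∈ Finset.range N, x i / q.toReal ^ i) * q.toReal ^ n := by
    intro n
    have hS : 0 ≤ ∑ i ∈ Finset.range N, x i / q.toReal ^ i :=
      Finset.sum_nonneg fun i _ => div_nonneg (hx0 i) (by positivity)
    by_cases hn : N ≤ n
    · have := hlarge n hn
      have h3 : 0 ≤ q.toReal ^ n := by positivity
      nlinarith
    · have h4 : x n / q.toReal ^ n ≤ ∑ i ∈ Finset.range N, x i / q.toReal ^ i :=
        Finset.single_le_sum (f := fun i => x i / q.toReal ^ i)
          (fun i _ => div_nonneg (hx0 i) (by positivity)) (Finset.mem_range.2 (not_le.1 hn))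
      rw [← div_le_iff₀ (by positivity)]
      linarith
  exact fun n => ⟨(le_add_of_nonneg_right (abs_nonneg _)).trans (key n),
    (le_add_of_nonneg_left (abs_nonneg _)).trans (key n)⟩

theorem GeometricDecay.strip {J : JacobiMatrix} (hJ : J.GeometricDecay) :
    J.strip.GeometricDecay := by
  obtain ⟨C, q, hq, hq1, hC⟩ := hJ
  refine ⟨C * q, q, hq, hq1, fun n => ?_⟩
  have := hC (n + 1)
  rw [pow_succ', ← mul_assoc] at this
  exact this

/-- The off-diagonal parameters `a_0 = 1, a_1, a_2, …`. -/
def offDiag (J : JacobiMatrix) : ℕ → ℝ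
  | 0 => 1
  | n + 1 => J.a n

theorem offDiag_pos (J : JacobiMatrix) : ∀ n, 0 < J.offDiag n
  | 0 => one_pos
  | n + 1 => J.a_pos n

/-- An analytic family of renormalized Jost solutions `f_n(z) = z^{-n} ψ_n(z)` on the disk of
radius `R > 1`. -/
structure IsJostFamily (J : JacobiMatrix) (R : ℝ) (f : ℕ → ℂ → ℂ) : Prop where
  one_lt : 1 < R
  differentiableOn : ∀ n, DifferentiableOn ℂ (f n) (Metric.ball 0 R)
  recurrence : ∀ n, ∀ z ∈ Metric.ball (0 : ℂ) R, J.offDiag n * f n z =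
    (z ^ 2 + 1 - J.b n * z) * f (n + 1) z - J.offDiag (n + 1) * z ^ 2 * f (n + 2) z
  tendsto_one : ∀ z ∈ Metric.ball (0 : ℂ) R, Tendsto (fun n => f n z) atTop (𝓝 1)

/-- The backward recursion, started `k` steps above the index `m` from the constant `1`. -/
def approx (J : JacobiMatrix) (z : ℂ) : ℕ → ℕ → ℂ
  | 0, _ => 1
  | 1, m => ((z ^ 2 + 1 - J.b m * z) - J.offDiag (m + 1) * z ^ 2) / J.offDiag m
  | k + 2, m => ((z ^ 2 + 1 - J.b m * z) * J.approx z (k + 1) (m + 1) -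
      J.offDiag (m + 1) * z ^ 2 * J.approx z k (m + 2)) / J.offDiag m

theorem approx_succ_succ (J : JacobiMatrix) (z : ℂ) (k m : ℕ) :
    J.offDiag m * J.approx z (k + 2) m = (z ^ 2 + 1 - J.b m * z) * J.approx z (k + 1) (m + 1) -
      J.offDiag (m + 1) * z ^ 2 * J.approx z k (m + 2) := by
  have : (J.offDiag m : ℂ) ≠ 0 := by exact_mod_cast (J.offDiag_pos m).ne'
  rw [approx]; field_simp

theorem differentiable_approx (J : JacobiMatrix) :
    ∀ k m, Differentiable ℂ fun z => J.approx z k m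
  | 0, m => by simp only [approx]; fun_prop
  | 1, m => by simp only [approx]; fun_prop
  | k + 2, m => by
    have h1 := J.differentiable_approx (k + 1) (m + 1)
    have h2 := J.differentiable_approx k (m + 2)
    simp only [approx]; fun_prop

def approxDiff (J : JacobiMatrix) (z : ℂ) (k m : ℕ) : ℂ :=
  J.approx z (k + 1) m - J.approx z k m

/-- The first-order quantity `h_k(m) - a_m h_{k-1}(m+1)` attached to `approxDiff`. -/
def approxSlope (J : JacobiMatrix) (z : ℂ) : ℕ → ℕ → ℂ
  | 0, m => J.approxDiff z 0 m
  | k + 1, m => J.approxDiff z (k + 1) m - J.offDiag m * J.approxDiff z k (m + 1)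

/-- With `approxSlope_succ` this is the recursion in the coordinates (difference, slope). For free
coefficients one step is triangular with diagonal 1, z². The parameters b_m and a_m - 1 only perturb
it. -/
theorem approxDiff_succ (J : JacobiMatrix) (z : ℂ) (k m : ℕ) :
    J.approxDiff z (k + 1) m = (J.offDiag m : ℂ)⁻¹ *
      ((1 - J.b m * z) * J.approxDiff z k (m + 1) + z ^ 2 * J.approxSlope z k (m + 1)) := by
  have : (J.offDiag m : ℂ) ≠ 0 := by exact_mod_cast (J.offDiag_pos m).ne'
  have : (J.offDiag (m + 1) : ℂ) ≠ 0 := by exact_mod_cast (J.offDiag_pos (m + 1)).ne'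
  cases k with
  | zero => simp only [approxDiff, approxSlope, approx]; field_simp; ring
  | succ k => simp only [approxDiff, approxSlope, approx]; field_simp; ring

theorem approxSlope_succ (J : JacobiMatrix) (z : ℂ) (k m : ℕ) :
    J.approxSlope z (k + 1) m = (J.offDiag m : ℂ)⁻¹ * (z ^ 2 * J.approxSlope z k (m + 1)) +
      ((J.offDiag m : ℂ)⁻¹ - J.offDiag m - (J.offDiag m : ℂ)⁻¹ * (J.b m * z)) *
        J.approxDiff z k (m + 1) := by
  rw [approxSlope, approxDiff_succ]; ring

/-- In the norm η|difference| + |slope| the step has norm at most ρ: `h1` and `h2` bound its two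
columns. A small weight η makes the off-diagonal entry z² cheap. -/
theorem norm_approx_step_le (J : JacobiMatrix) {R η ρ E : ℝ} (hη : 0 ≤ η)
    {z : ℂ} (hz : ‖z‖ ≤ R) {k m : ℕ}
    (h1 : η * ((J.offDiag m)⁻¹ * (1 + |J.b m| * R)) +
      (|(J.offDiag m)⁻¹ - J.offDiag m| + (J.offDiag m)⁻¹ * (|J.b m| * R)) ≤ ρ * η)
    (h2 : (J.offDiag m)⁻¹ * R ^ 2 * (1 + η) ≤ ρ) (hρ : 0 ≤ ρ)
    (hE : η * ‖J.approxDiff z k (m + 1)‖ + ‖J.approxSlope z k (m + 1)‖ ≤ E) :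
    η * ‖J.approxDiff z (k + 1) m‖ + ‖J.approxSlope z (k + 1) m‖ ≤ ρ * E := by
  have hα : 0 < (J.offDiag m)⁻¹ := inv_pos.2 (J.offDiag_pos m)
  have hnα : ‖(J.offDiag m : ℂ)⁻¹‖ = (J.offDiag m)⁻¹ := by
    rw [← Complex.ofReal_inv, Complex.norm_real, Real.norm_eq_abs, abs_of_pos hα]
  set p := ‖J.approxDiff z k (m + 1)‖
  set d := ‖J.approxSlope z k (m + 1)‖
  have hp : 0 ≤ p := norm_nonneg _
  have hd : 0 ≤ d := norm_nonneg _
  have hbz : ‖(J.b m : ℂ) * z‖ ≤ |J.b m| * R := by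
    rw [norm_mul, Complex.norm_real, Real.norm_eq_abs]
    exact mul_le_mul_of_nonneg_left hz (abs_nonneg _)
  have hz2 : ‖z ^ 2‖ ≤ R ^ 2 := by
    rw [norm_pow]; exact pow_le_pow_left₀ (norm_nonneg _) hz 2
  have e1 : ‖J.approxDiff z (k + 1) m‖ ≤
      (J.offDiag m)⁻¹ * ((1 + |J.b m| * R) * p + R ^ 2 * d) := by
    rw [approxDiff_succ, norm_mul, hnα]
    refine mul_le_mul_of_nonneg_left ((norm_add_le _ _).trans ?_) hα.le
    rw [norm_mul, norm_mul]
    gcongr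
    exact (norm_sub_le _ _).trans (by simpa using hbz)
  have e2 : ‖J.approxSlope z (k + 1) m‖ ≤ (J.offDiag m)⁻¹ * (R ^ 2 * d) +
      (|(J.offDiag m)⁻¹ - J.offDiag m| + (J.offDiag m)⁻¹ * (|J.b m| * R)) * p := by
    rw [approxSlope_succ]
    refine (norm_add_le _ _).trans ?_
    rw [norm_mul, norm_mul, norm_mul, hnα]
    gcongr
    refine (norm_sub_le _ _).trans ?_
    rw [norm_mul, hnα, ← Complex.ofReal_inv, ← Complex.ofReal_sub, Complex.norm_real,
      Real.norm_eq_abs]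
    gcongr
  calc _ ≤ η * ((J.offDiag m)⁻¹ * ((1 + |J.b m| * R) * p + R ^ 2 * d)) +
        ((J.offDiag m)⁻¹ * (R ^ 2 * d) +
        (|(J.offDiag m)⁻¹ - J.offDiag m| + (J.offDiag m)⁻¹ * (|J.b m| * R)) * p) := by
        gcongr
    _ = (η * ((J.offDiag m)⁻¹ * (1 + |J.b m| * R)) +
      (|(J.offDiag m)⁻¹ - J.offDiag m| + (J.offDiag m)⁻¹ * (|J.b m| * R))) * p +
        ((J.offDiag m)⁻¹ * R ^ 2 * (1 + η)) * d := by ring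
    _ ≤ (ρ * η) * p + ρ * d := by gcongr
    _ = ρ * (η * p + d) := by ring
    _ ≤ ρ * E := by gcongr

/-- The constant 1 solves the free recursion, so the first increment is of the size of the
perturbation at m. -/
theorem norm_approxDiff_zero_le (J : JacobiMatrix) {R C q : ℝ} {z : ℂ} (hz : ‖z‖ ≤ R)
    {m : ℕ} (hα : (J.offDiag m)⁻¹ ≤ 2) (ha : |J.offDiag m - 1| ≤ C * q ^ m)
    (ha' : |J.offDiag (m + 1) - 1| ≤ C * q ^ m) (hb : |J.b m| ≤ C * q ^ m) :
    ‖J.approxDiff z 0 m‖ ≤ 2 * (1 + R ^ 2 + R) * C * q ^ m := by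
  have hα0 : 0 < (J.offDiag m)⁻¹ := inv_pos.2 (J.offDiag_pos m)
  have hne : (J.offDiag m : ℂ) ≠ 0 := by exact_mod_cast (J.offDiag_pos m).ne'
  have hnα : ‖(J.offDiag m : ℂ)⁻¹‖ = (J.offDiag m)⁻¹ := by
    rw [← Complex.ofReal_inv, Complex.norm_real, Real.norm_eq_abs, abs_of_pos hα0]
  have hR : 0 ≤ R := (norm_nonneg z).trans hz
  have e : J.approxDiff z 0 m = (J.offDiag m : ℂ)⁻¹ *
      (((1 - J.offDiag m : ℝ) : ℂ) + z ^ 2 * ((1 - J.offDiag (m + 1) : ℝ) : ℂ) - J.b m * z) := by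
    simp only [approxDiff, approx]; push_cast; field_simp; ring
  have h0 : 0 ≤ C * q ^ m := (abs_nonneg _).trans hb
  rw [e, norm_mul, hnα]
  calc _ ≤ 2 * (C * q ^ m + R ^ 2 * (C * q ^ m) + (C * q ^ m) * R) := by
        refine mul_le_mul hα ?_ (norm_nonneg _) (by norm_num)
        refine (norm_sub_le _ _).trans (add_le_add ((norm_add_le _ _).trans (add_le_add ?_ ?_)) ?_)
        · rw [Complex.norm_real, Real.norm_eq_abs, abs_sub_comm]; exact ha
        · rw [norm_mul, norm_pow, Complex.norm_real, Real.norm_eq_abs, abs_sub_comm]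
          gcongr
        · rw [norm_mul, Complex.norm_real, Real.norm_eq_abs]; gcongr
    _ = _ := by ring

/-- Each step costs a factor ρ but moves the base index from m to m + 1, where the initial increment
is smaller by q. Hence the ratio θ = ρq, which is below 1 once ρ < 1/q. -/
theorem exists_norm_approxDiff_le (J : JacobiMatrix) {C q : ℝ} (hq : 0 < q) (hq1 : q < 1)
    (hC : ∀ n, |J.b n| ≤ C * q ^ n ∧ |J.a n - 1| ≤ C * q ^ n) :
    ∃ R θ K : ℝ, ∃ N : ℕ, 1 < R ∧ 0 ≤ θ ∧ θ < 1 ∧ ∀ k m, N ≤ m → ∀ z : ℂ, ‖z‖ ≤ R →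
      ‖J.approxDiff z k m‖ ≤ K * q ^ m * θ ^ k := by
  -- The choice is 1 < s = R² < ρ < 1/q and t = 1 + η > 1 with st < ρ, so that both column bounds
  -- hold strictly in the limit m → ∞.
  obtain ⟨ρ, hρ1, hρ⟩ := exists_between ((one_lt_inv₀ hq).2 hq1)
  obtain ⟨s, hs1, hs⟩ := exists_between hρ1
  obtain ⟨t, ht1, ht⟩ := exists_between ((one_lt_div (by linarith)).2 hs : 1 < ρ / s)
  set R := √s with hR
  have hR1 : 1 < R := by rw [hR, Real.lt_sqrt (by norm_num)]; simpa using hs1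
  have hR2 : R ^ 2 = s := Real.sq_sqrt (by linarith)
  have hC0 : 0 ≤ C := by simpa using (abs_nonneg _).trans (hC 0).1
  -- The index of `offDiag` is one ahead of that of `a`, which costs one factor q.
  set C' := C * q⁻¹ with hC'
  have hqi : 1 < q⁻¹ := (one_lt_inv₀ hq).2 hq1
  have hCC' : C ≤ C' := le_mul_of_one_le_right hC0 hqi.le
  have hA : ∀ m, |J.offDiag m - 1| ≤ C' * q ^ m := by
    intro m
    cases m with
    | zero => simp [offDiag]; positivity
    | succ n =>
      have : C' * q ^ (n + 1) = C * q ^ n := by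
        rw [hC', pow_succ]; field_simp
      rw [this]; exact (hC n).2
  have hA' : ∀ m, |J.offDiag (m + 1) - 1| ≤ C' * q ^ m := fun m =>
    (hC m).2.trans (by gcongr)
  have hB : ∀ m, |J.b m| ≤ C' * q ^ m := fun m => (hC m).1.trans (by gcongr)
  have hlim : Tendsto (fun m : ℕ => C' * q ^ m) atTop (𝓝 0) := by
    simpa using (tendsto_pow_atTop_nhds_zero_of_lt_one hq.le hq1).const_mul C'
  have tB : Tendsto (fun m => |J.b m|) atTop (𝓝 0) :=
    squeeze_zero (fun _ => abs_nonneg _) hB hlim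
  have tA : Tendsto J.offDiag atTop (𝓝 1) := by
    rw [tendsto_iff_norm_sub_tendsto_zero]
    exact squeeze_zero (fun _ => norm_nonneg _) hA hlim
  have tα : Tendsto (fun m => (J.offDiag m)⁻¹) atTop (𝓝 1) := by
    simpa using tA.inv₀ one_ne_zero
  set η := t - 1 with hη
  have hη0 : 0 < η := by rw [hη]; linarith
  have l1 : Tendsto (fun m => η * ((J.offDiag m)⁻¹ * (1 + |J.b m| * R)) +
      (|(J.offDiag m)⁻¹ - J.offDiag m| + (J.offDiag m)⁻¹ * (|J.b m| * R))) atTop (𝓝 η) := by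
    have := ((tα.mul ((tB.mul_const R).const_add 1)).const_mul η).add
      ((tα.sub tA).abs.add (tα.mul (tB.mul_const R)))
    simpa using this
  have l2 : Tendsto (fun m => (J.offDiag m)⁻¹ * R ^ 2 * (1 + η)) atTop (𝓝 (s * t)) := by
    have := (tα.mul_const (R ^ 2)).mul_const (1 + η)
    rw [hR2] at this ⊢
    simpa [hη] using this
  have ev := (l1.eventually_le_const (by nlinarith : η < ρ * η)).and
    ((l2.eventually_le_const (by rwa [mul_comm, ← lt_div_iff₀ (by linarith)] : s * t < ρ)).and
      (tα.eventually_le_const (by norm_num : (1 : ℝ) < 2)))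
  obtain ⟨N, hN⟩ := eventually_atTop.1 ev
  set K := (1 + η) * (2 * (1 + R ^ 2 + R) * C') with hK
  have hmain : ∀ k m, N ≤ m → ∀ z : ℂ, ‖z‖ ≤ R →
      η * ‖J.approxDiff z k m‖ + ‖J.approxSlope z k m‖ ≤ K * q ^ m * (ρ * q) ^ k := by
    intro k
    induction k with
    | zero =>
      intro m hm z hz
      have := J.norm_approxDiff_zero_le hz (hN m hm).2.2 (hA m) (hA' m) (hB m)
      rw [approxSlope, pow_zero, mul_one, hK]
      nlinarith
    | succ k ih =>
      intro m hm z hz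
      have := J.norm_approx_step_le hη0.le hz (hN m hm).1 (hN m hm).2.1 (by linarith)
        (ih (m + 1) (by omega) z hz)
      refine this.trans (le_of_eq ?_)
      ring
  refine ⟨R, ρ * q, K / η, N, hR1, by positivity, ?_, fun k m hm z hz => ?_⟩
  · rwa [← lt_div_iff₀ hq, one_div]
  · have := hmain k m hm z hz
    have h3 : η * ‖J.approxDiff z k m‖ ≤ K * q ^ m * (ρ * q) ^ k :=
      (le_add_of_nonneg_right (norm_nonneg _)).trans this
    rw [← le_div_iff₀' hη0] at h3
    refine h3.trans (le_of_eq ?_)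
    ring

/-- The convergence estimate is available only for m ≥ N; the remaining f_n follow by solving the
recurrence downwards, which divides only by a_n ≠ 0. -/
theorem exists_extend_recurrence (J : JacobiMatrix) {s : Set ℂ} (N : ℕ) (f : ℕ → ℂ → ℂ)
    (hd : ∀ n, N ≤ n → DifferentiableOn ℂ (f n) s)
    (hr : ∀ n, N ≤ n → ∀ z ∈ s, J.offDiag n * f n z =
      (z ^ 2 + 1 - J.b n * z) * f (n + 1) z - J.offDiag (n + 1) * z ^ 2 * f (n + 2) z) :
    ∃ g : ℕ → ℂ → ℂ, (∀ n, N ≤ n → g n = f n) ∧ (∀ n, DifferentiableOn ℂ (g n) s) ∧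
      ∀ n, ∀ z ∈ s, J.offDiag n * g n z =
        (z ^ 2 + 1 - J.b n * z) * g (n + 1) z - J.offDiag (n + 1) * z ^ 2 * g (n + 2) z := by
  induction N generalizing f with
  | zero => exact ⟨f, fun _ _ => rfl, fun n => hd n (Nat.zero_le n), fun n => hr n (Nat.zero_le n)⟩
  | succ N ih =>
    set F : ℂ → ℂ := fun z => ((z ^ 2 + 1 - J.b N * z) * f (N + 1) z -
      J.offDiag (N + 1) * z ^ 2 * f (N + 2) z) / J.offDiag N with hF
    have hd' : ∀ n, N ≤ n → DifferentiableOn ℂ (Function.update f N F n) s := by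
      intro n hn
      rcases hn.eq_or_lt with rfl | hn
      · rw [Function.update_self]
        have h1 := hd (N + 1) (by omega)
        have h2 := hd (N + 2) (by omega)
        fun_prop
      · rw [Function.update_of_ne (by omega)]; exact hd n hn
    have hr' : ∀ n, N ≤ n → ∀ z ∈ s, J.offDiag n * Function.update f N F n z =
        (z ^ 2 + 1 - J.b n * z) * Function.update f N F (n + 1) z -
          J.offDiag (n + 1) * z ^ 2 * Function.update f N F (n + 2) z := by
      intro n hn z hz
      rw [Function.update_of_ne (show n + 1 ≠ N by omega),
        Function.update_of_ne (show n + 2 ≠ N by omega)]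
      rcases hn.eq_or_lt with rfl | hn
      · rw [Function.update_self, hF]
        have : (J.offDiag N : ℂ) ≠ 0 := by exact_mod_cast (J.offDiag_pos N).ne'
        field_simp
      · rw [Function.update_of_ne (by omega)]; exact hr n hn z hz
    obtain ⟨g, hg, hgd, hgr⟩ := ih _ hd' hr'
    refine ⟨g, fun n hn => ?_, hgd, hgr⟩
    rw [hg n (by omega), Function.update_of_ne (by omega)]

theorem GeometricDecay.exists_isJostFamily {J : JacobiMatrix} (hJ : J.GeometricDecay) :
    ∃ R f, J.IsJostFamily R f := by
  obtain ⟨C, q, hq, hq1, hC⟩ := hJ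
  obtain ⟨R, θ, K, N, hR, hθ, hθ1, hb⟩ := J.exists_norm_approxDiff_le hq hq1 hC
  have hmem : ∀ {z : ℂ}, z ∈ Metric.ball (0 : ℂ) R → ‖z‖ ≤ R := fun hz => by
    simpa using (mem_ball_zero_iff.1 hz).le
  have hsum : ∀ m, Summable fun k : ℕ => K * q ^ m * θ ^ k := fun m =>
    (summable_geometric_of_lt_one hθ hθ1).mul_left _
  set F : ℕ → ℂ → ℂ := fun m z => 1 + ∑' k, J.approxDiff z k m with hF
  have hlim : ∀ m, N ≤ m → ∀ z ∈ Metric.ball (0 : ℂ) R,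
      Tendsto (fun k => J.approx z k m) atTop (𝓝 (F m z)) := by
    intro m hm z hz
    have hs : Summable fun k => J.approxDiff z k m :=
      .of_norm_bounded (hsum m) fun k => hb k m hm z (hmem hz)
    have := hs.hasSum.tendsto_sum_nat.const_add 1
    refine this.congr fun k => ?_
    simp only [approxDiff]
    rw [Finset.sum_range_sub (fun k => J.approx z k m)]
    simp [approx]
  have hd : ∀ m, N ≤ m → DifferentiableOn ℂ (F m) (Metric.ball 0 R) := by
    intro m hm
    refine (Complex.differentiableOn_tsum_of_summable_norm (hsum m) (fun k => ?_) Metric.isOpen_ball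
      fun k z hz => hb k m hm z (hmem hz)).const_add 1
    exact ((J.differentiable_approx (k + 1) m).sub (J.differentiable_approx k m)).differentiableOn
  have hr : ∀ m, N ≤ m → ∀ z ∈ Metric.ball (0 : ℂ) R, J.offDiag m * F m z =
      (z ^ 2 + 1 - J.b m * z) * F (m + 1) z - J.offDiag (m + 1) * z ^ 2 * F (m + 2) z := by
    intro m hm z hz
    have h0 := ((hlim m hm z hz).comp (tendsto_add_atTop_nat 2)).const_mul (J.offDiag m : ℂ)
    have h1 := ((hlim (m + 1) (by omega) z hz).comp (tendsto_add_atTop_nat 1)).const_mul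
      (z ^ 2 + 1 - J.b m * z)
    have h2 := (hlim (m + 2) (by omega) z hz).const_mul (J.offDiag (m + 1) * z ^ 2 : ℂ)
    refine tendsto_nhds_unique h0 ((h1.sub h2).congr fun k => ?_)
    exact (J.approx_succ_succ z k m).symm
  obtain ⟨g, hg, hgd, hgr⟩ := J.exists_extend_recurrence N F hd hr
  refine ⟨R, g, hR, hgd, hgr, fun z hz => ?_⟩
  have hbound : ∀ m, N ≤ m → ‖g m z - 1‖ ≤ K * q ^ m * (1 - θ)⁻¹ := by
    intro m hm
    rw [hg m hm, hF, add_sub_cancel_left, ← tsum_geometric_of_lt_one hθ hθ1, ← tsum_mul_left]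
    exact tsum_of_norm_bounded (hsum m).hasSum fun k => hb k m hm z (hmem hz)
  rw [tendsto_iff_norm_sub_tendsto_zero]
  refine squeeze_zero' (Eventually.of_forall fun _ => norm_nonneg _)
    (eventually_atTop.2 ⟨N, hbound⟩) ?_
  simpa using ((tendsto_pow_atTop_nhds_zero_of_lt_one hq.le hq1).const_mul K).mul_const
    (1 - θ)⁻¹

/-- The Jost family of the stripped matrix. -/
def stripFamily (J : JacobiMatrix) (f : ℕ → ℂ → ℂ) : ℕ → ℂ → ℂ
  | 0 => fun z => J.a 0 * f 1 z
  | n + 1 => f (n + 2)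

/-- The solution for J^{(1)} is z^{-1} ψ_{n+1}, so the renormalized family just shifts. Only entry 0
changes: a_1 is replaced there by the conventional coefficient 1, and f_0 absorbs it. -/
theorem IsJostFamily.strip {J : JacobiMatrix} {R : ℝ} {f : ℕ → ℂ → ℂ} (h : J.IsJostFamily R f) :
    J.strip.IsJostFamily R (J.stripFamily f) where
  one_lt := h.one_lt
  differentiableOn
    | 0 => (h.differentiableOn 1).const_mul _
    | n + 1 => h.differentiableOn (n + 2)
  recurrence
    | 0 => fun z hz => by simpa [offDiag, stripFamily, JacobiMatrix.strip] using h.recurrence 1 z hz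
    | n + 1 => fun z hz => h.recurrence (n + 2) z hz
  tendsto_one z hz := by
    rw [← tendsto_add_atTop_iff_nat 1]
    exact (tendsto_add_atTop_iff_nat 2).2 (h.tendsto_one z hz)

end JacobiMatrix

/-! ### Wronskians and uniqueness of the Jost solution -/

namespace JacobiMatrix

/-- `φ` solves the difference equation `Jφ = Eφ` on the whole half line, with the value at `0`
included and `a_0 = 1`. -/
def Solves (J : JacobiMatrix) (E : ℂ) (φ : ℕ → ℂ) : Prop :=
  ∀ n, J.offDiag n * φ n + J.b n * φ (n + 1) + J.offDiag (n + 1) * φ (n + 2) = E * φ (n + 1)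

theorem offDiag_ne_zero (J : JacobiMatrix) (n : ℕ) : (J.offDiag n : ℂ) ≠ 0 := by
  exact_mod_cast (J.offDiag_pos n).ne'

theorem exists_norm_offDiag_le (J : JacobiMatrix) : ∃ K : ℝ, ∀ n, ‖(J.offDiag n : ℂ)‖ ≤ K := by
  obtain ⟨K, hK⟩ := J.bounded
  refine ⟨max 1 K, fun n => ?_⟩
  rw [Complex.norm_real, Real.norm_eq_abs]
  cases n with
  | zero => simp [offDiag]
  | succ n => exact le_max_of_le_right (hK n).1

/-- The Wronskian `a_n (φ_n ψ_{n+1} - φ_{n+1} ψ_n)`. -/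
def wronskian (J : JacobiMatrix) (φ ψ : ℕ → ℂ) (n : ℕ) : ℂ :=
  J.offDiag n * (φ n * ψ (n + 1) - φ (n + 1) * ψ n)

theorem Solves.wronskian_eq {J : JacobiMatrix} {E : ℂ} {φ ψ : ℕ → ℂ} (hφ : J.Solves E φ)
    (hψ : J.Solves E ψ) (n : ℕ) : J.wronskian φ ψ n = J.wronskian φ ψ 0 := by
  induction n with
  | zero => rfl
  | succ n ih =>
    rw [← ih, wronskian, wronskian]
    linear_combination φ (n + 1) * hψ n - ψ (n + 1) * hφ n

theorem Solves.sub {J : JacobiMatrix} {E : ℂ} {φ ψ : ℕ → ℂ} (hφ : J.Solves E φ)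
    (hψ : J.Solves E ψ) : J.Solves E (φ - ψ) := fun n => by
  simp only [Pi.sub_apply]
  linear_combination hφ n - hψ n

theorem Solves.eq_zero_of_ge {J : JacobiMatrix} {E : ℂ} {φ : ℕ → ℂ} (hφ : J.Solves E φ) (N : ℕ)
    (h : ∀ n, N ≤ n → φ n = 0) : φ = 0 := by
  induction N with
  | zero => exact funext fun n => h n (Nat.zero_le n)
  | succ N ih =>
    refine ih fun n hn => ?_
    rcases hn.eq_or_lt with rfl | hn
    · have := hφ N
      rw [h (N + 1) le_rfl, h (N + 2) (by omega)] at this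
      simpa [J.offDiag_ne_zero N] using this
    · exact h n hn

theorem Solves.eq_zero_of_two {J : JacobiMatrix} {E : ℂ} {φ : ℕ → ℂ} (hφ : J.Solves E φ)
    (h0 : φ 0 = 0) (h1 : φ 1 = 0) : φ = 0 := by
  have : ∀ n, φ n = 0 ∧ φ (n + 1) = 0 := by
    intro n
    induction n with
    | zero => exact ⟨h0, h1⟩
    | succ n ih =>
      refine ⟨ih.2, ?_⟩
      have := hφ n
      rw [ih.1, ih.2] at this
      simpa [J.offDiag_ne_zero (n + 1)] using this
  exact funext fun n => (this n).1

variable {J : JacobiMatrix} {z : ℂ} {ψ : ℕ → ℂ}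

theorem IsJostSolution.solves (h : J.IsJostSolution z ψ) : J.Solves (z + z⁻¹) ψ
  | 0 => by simpa [offDiag] using h.first
  | n + 1 => h.step n

theorem IsJostSolution.exists_norm_le (h : J.IsJostSolution z ψ) (hz : z ≠ 0) :
    ∃ C, ∀ n, ‖ψ n‖ ≤ C * ‖z‖ ^ n := by
  obtain ⟨C, hC⟩ := h.asymp.norm.bddAbove_range
  refine ⟨C, fun n => ?_⟩
  have := hC ⟨n, rfl⟩
  simp only [norm_mul, norm_inv, norm_pow] at this
  rwa [inv_mul_le_iff₀ (by positivity), mul_comm] at this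

theorem IsJostSolution.tendsto_zero (h : J.IsJostSolution z ψ) (hz : z ≠ 0) (hz1 : ‖z‖ < 1) :
    Tendsto ψ atTop (𝓝 0) := by
  obtain ⟨C, hC⟩ := h.exists_norm_le hz
  refine squeeze_zero_norm hC ?_
  simpa using (tendsto_pow_atTop_nhds_zero_of_lt_one (norm_nonneg z) hz1).const_mul C

theorem IsJostSolution.ne_zero (h : J.IsJostSolution z ψ) : ψ ≠ 0 := by
  rintro rfl
  exact one_ne_zero (tendsto_nhds_unique h.asymp (by simp))

theorem Solves.wronskian_eq_zero {E : ℂ} {φ χ : ℕ → ℂ} (hφ : J.Solves E φ) (hχ : J.Solves E χ)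
    (tφ : Tendsto φ atTop (𝓝 0)) (tχ : Tendsto χ atTop (𝓝 0)) (n : ℕ) :
    J.wronskian φ χ n = 0 := by
  have hc : ∀ n, J.wronskian φ χ n = J.wronskian φ χ 0 := hφ.wronskian_eq hχ
  obtain ⟨K, hK⟩ := J.exists_norm_offDiag_le
  have t : Tendsto (fun n => φ n * χ (n + 1) - φ (n + 1) * χ n) atTop (𝓝 0) := by
    have := (tφ.mul ((tendsto_add_atTop_iff_nat 1).2 tχ)).sub
      (((tendsto_add_atTop_iff_nat 1).2 tφ).mul tχ)
    simpa using this
  have t' : Tendsto (J.wronskian φ χ) atTop (𝓝 0) := by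
    refine squeeze_zero_norm (fun n => ?_) (by simpa using t.norm.const_mul K)
    rw [wronskian, norm_mul]
    exact mul_le_mul_of_nonneg_right (hK n) (norm_nonneg _)
  have hW : J.wronskian φ χ = fun _ => J.wronskian φ χ 0 := funext hc
  rw [hc n]
  rw [hW] at t'
  exact tendsto_nhds_unique tendsto_const_nhds t'

/-- Both solutions decay, so their Wronskian vanishes and their ratio is constant for large n. The
normalization makes it 1, and the recurrence carries equality down to n = 0. -/
theorem IsJostSolution.unique {φ : ℕ → ℂ} (hφ : J.IsJostSolution z φ)
    (hψ : J.IsJostSolution z ψ) (hz : z ≠ 0) (hz1 : ‖z‖ < 1) : φ = ψ := by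
  have hW := hφ.solves.wronskian_eq_zero hψ.solves (hφ.tendsto_zero hz hz1)
    (hψ.tendsto_zero hz hz1)
  have key : ∀ n, φ n * ψ (n + 1) = φ (n + 1) * ψ n := fun n => by
    have := hW n
    rw [wronskian, mul_eq_zero, or_iff_right (J.offDiag_ne_zero n)] at this
    exact sub_eq_zero.1 this
  obtain ⟨N, hN⟩ := eventually_atTop.1 (hψ.asymp.eventually_ne one_ne_zero)
  have hne : ∀ n, N ≤ n → ψ n ≠ 0 := fun n hn h => hN n hn (by simp [h])
  have hconst : ∀ n, N ≤ n → φ n / ψ n = φ N / ψ N := by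
    intro n hn
    induction n, hn using Nat.le_induction with
    | base => rfl
    | succ n hn ih =>
      rw [← ih, div_eq_div_iff (hne _ (by omega)) (hne n hn)]
      exact (key n).symm
  have hone : φ N / ψ N = 1 := by
    have t := hφ.asymp.div hψ.asymp one_ne_zero
    rw [div_one] at t
    refine tendsto_nhds_unique (tendsto_const_nhds.congr' ?_) t
    filter_upwards [eventually_ge_atTop N] with n hn
    rw [Pi.div_apply, mul_div_mul_left _ _ (inv_ne_zero (pow_ne_zero n hz)), hconst n hn]
  have := (hφ.solves.sub hψ.solves).eq_zero_of_ge N fun n hn => by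
    have := hconst n hn
    rw [hone, div_eq_one_iff_eq (hne n hn)] at this
    simp [this]
  exact sub_eq_zero.1 this

theorem IsJostFamily.solves {R : ℝ} {f : ℕ → ℂ → ℂ} (h : J.IsJostFamily R f) (hz : z ≠ 0)
    (hzR : ‖z‖ < R) : J.Solves (z + z⁻¹) fun n => z ^ n * f n z := by
  intro n
  have := h.recurrence n z (by simpa using hzR)
  simp only [pow_succ]
  field_simp
  linear_combination this

theorem IsJostFamily.isJostSolution {R : ℝ} {f : ℕ → ℂ → ℂ} (h : J.IsJostFamily R f) (hz : z ≠ 0)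
    (hz1 : ‖z‖ < 1) : J.IsJostSolution z fun n => z ^ n * f n z where
  first := by simpa [offDiag] using h.solves hz (hz1.trans h.one_lt) 0
  step n := h.solves hz (hz1.trans h.one_lt) (n + 1)
  asymp := by
    refine (h.tendsto_one z (by simpa using hz1.trans h.one_lt)).congr fun n => ?_
    rw [inv_mul_cancel_left₀ (pow_ne_zero n hz)]

/-! ### Self-adjointness and the Jost vector -/

theorem summable_mul_shift (J : JacobiMatrix) (v w : L2) :
    Summable fun n => (J.a n : ℂ) * (v n * w (n + 1)) := by
  obtain ⟨K, hK⟩ := J.bounded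
  refine .of_norm_bounded (((summable_sq v).add
    ((summable_nat_add_iff 1).2 (summable_sq w))).mul_left K) fun n => ?_
  have h1 := (hK n).1
  have h2 : ‖v n‖ * ‖w (n + 1)‖ ≤ ‖v n‖ ^ 2 + ‖w (n + 1)‖ ^ 2 := by
    nlinarith [sq_nonneg (‖v n‖ - ‖w (n + 1)‖), sq_nonneg ‖v n‖, sq_nonneg ‖w (n + 1)‖]
  rw [norm_mul, norm_mul, Complex.norm_real, Real.norm_eq_abs]
  have h0 : 0 ≤ K := (abs_nonneg _).trans h1
  gcongr

theorem op_apply (J : JacobiMatrix) (v : L2) (n : ℕ) : J.op v n = J.act v n := rfl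

theorem tsum_delay {g g' : ℕ → ℂ} (hg : Summable g) (h0 : g' 0 = 0) (h : ∀ n, g' (n + 1) = g n) :
    Summable g' ∧ ∑' n, g' n = ∑' n, g n := by
  have hs : Summable g' := (summable_nat_add_iff 1).1 (by simpa only [h] using hg)
  refine ⟨hs, ?_⟩
  rw [hs.tsum_eq_zero_add, h0, zero_add]
  exact tsum_congr h

theorem inner_act_sub_inner_act_zero (J : JacobiMatrix) (v w : ℕ → ℂ) :
    inner ℂ (J.act v 0) (w 0) - inner ℂ (v 0) (J.act w 0) +
      ((J.a 0 : ℂ) * (star v 0 * w 1) - (J.a 0 : ℂ) * (w 0 * star v 1)) = 0 := by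
  simp only [act, RCLike.inner_apply, map_add, map_mul, Complex.conj_ofReal, Pi.star_apply,
    RCLike.star_def]
  ring

theorem inner_act_sub_inner_act_succ (J : JacobiMatrix) (v w : ℕ → ℂ) (n : ℕ) :
    inner ℂ (J.act v (n + 1)) (w (n + 1)) - inner ℂ (v (n + 1)) (J.act w (n + 1)) +
      ((J.a (n + 1) : ℂ) * (star v (n + 1) * w (n + 2)) -
        (J.a (n + 1) : ℂ) * (w (n + 1) * star v (n + 2))) =
      (J.a n : ℂ) * (star v n * w (n + 1)) - (J.a n : ℂ) * (w n * star v (n + 1)) := by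
  simp only [act, RCLike.inner_apply, map_add, map_mul, Complex.conj_ofReal, Pi.star_apply,
    RCLike.star_def]
  ring

/-- Summation by parts: the termwise difference plus the boundary term at n is the boundary term at
n - 1 (zero for n = 0). A summable series and its delay have equal sums, so the differences sum to
0. -/
theorem inner_op_left (J : JacobiMatrix) (v w : L2) :
    inner ℂ (J.op v) w = inner ℂ v (J.op w) := by
  have hS : Summable fun n => ((J.a n : ℂ) * (star (v : ℕ → ℂ) n * w (n + 1)) -
      (J.a n : ℂ) * (w n * star (v : ℕ → ℂ) (n + 1))) :=
    (J.summable_mul_shift (star v) w).sub (J.summable_mul_shift w (star v))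
  have h1 : HasSum (fun n => inner ℂ (J.act v n) (w n)) (inner ℂ (J.op v) w) :=
    lp.hasSum_inner (J.op v) w
  have h2 : HasSum (fun n => inner ℂ (v n) (J.act w n)) (inner ℂ v (J.op w)) :=
    lp.hasSum_inner v (J.op w)
  have h3 := (h1.sub h2).add hS.hasSum
  have e := (tsum_delay (g' := fun n => inner ℂ (J.act v n) (w n) - inner ℂ (v n) (J.act w n) +
    ((J.a n : ℂ) * (star (v : ℕ → ℂ) n * w (n + 1)) -
      (J.a n : ℂ) * (w n * star (v : ℕ → ℂ) (n + 1)))) hS (J.inner_act_sub_inner_act_zero v w)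
    (J.inner_act_sub_inner_act_succ v w)).2
  rw [h3.tsum_eq] at e
  exact sub_eq_zero.1 (add_eq_right.1 e)

theorem isSelfAdjoint_op (J : JacobiMatrix) : IsSelfAdjoint J.op :=
  ContinuousLinearMap.isSelfAdjoint_iff_isSymmetric.2 fun v w => J.inner_op_left v w

theorem delta_apply (n : ℕ) : delta n = if n = 0 then 1 else 0 := by
  rw [delta, lp.coeFn_single, Pi.single_apply]

theorem inner_delta_left (v : L2) : inner ℂ delta v = v 0 := by
  rw [delta, lp.inner_single_left]; simp

theorem IsJostSolution.memℓp (h : J.IsJostSolution z ψ) (hz : z ≠ 0) (hz1 : ‖z‖ < 1) :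
    Memℓp (fun n => ψ (n + 1)) 2 := by
  obtain ⟨C, hC⟩ := h.exists_norm_le hz
  refine memℓp_gen ?_
  have hg : Summable fun n : ℕ => C ^ 2 * (‖z‖ ^ 2) ^ (n + 1) :=
    ((summable_nat_add_iff 1).2 (summable_geometric_of_lt_one (by positivity)
      (pow_lt_one₀ (norm_nonneg z) hz1 two_ne_zero))).mul_left _
  have := Summable.of_nonneg_of_le (fun n => sq_nonneg ‖ψ (n + 1)‖) (fun n => ?_) hg
  · simpa using this
  · calc ‖ψ (n + 1)‖ ^ 2 ≤ (C * ‖z‖ ^ (n + 1)) ^ 2 :=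
        pow_le_pow_left₀ (norm_nonneg _) (hC _) 2
      _ = _ := by ring

/-- The square summable vector `(ψ_1, ψ_2, …)`. -/
def IsJostSolution.vec (h : J.IsJostSolution z ψ) (hz : z ≠ 0) (hz1 : ‖z‖ < 1) : L2 :=
  ⟨fun n => ψ (n + 1), h.memℓp hz hz1⟩

theorem IsJostSolution.vec_apply (h : J.IsJostSolution z ψ) (hz : z ≠ 0) (hz1 : ‖z‖ < 1) (n : ℕ) :
    h.vec hz hz1 n = ψ (n + 1) := rfl

theorem IsJostSolution.sub_op_vec (h : J.IsJostSolution z ψ) (hz : z ≠ 0) (hz1 : ‖z‖ < 1) :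
    (z + z⁻¹) • h.vec hz hz1 - J.op (h.vec hz hz1) = ψ 0 • delta := by
  refine lp.ext (funext fun n => ?_)
  simp only [lp.coeFn_sub, lp.coeFn_smul, Pi.sub_apply, Pi.smul_apply, op_apply, smul_eq_mul,
    delta_apply]
  cases n with
  | zero =>
    simp only [act, vec_apply, if_true]
    linear_combination -h.first
  | succ n =>
    simp only [act, vec_apply]
    simp only [Nat.add_eq_zero_iff, one_ne_zero, and_false, if_false, mul_zero]
    linear_combination -h.step n

/-- Pair (E - J)v = ψ_0 δ_1 with v and take imaginary parts, ⟨v, Jv⟩ being real. This one bound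
yields both the reality and the simplicity of the zeros of u. -/
theorem IsJostSolution.abs_im_mul_norm_le (h : J.IsJostSolution z ψ) (hz : z ≠ 0)
    (hz1 : ‖z‖ < 1) : |(z + z⁻¹).im| * ‖ψ 1‖ ≤ ‖ψ 0‖ := by
  set v := h.vec hz hz1 with hv
  have h1 : inner ℂ v ((z + z⁻¹) • v - J.op v) = ψ 0 * inner ℂ v delta := by
    rw [h.sub_op_vec, inner_smul_right]
  have hreal : (inner ℂ v (J.op v)).im = 0 := by
    have := inner_conj_symm (𝕜 := ℂ) v (J.op v)
    rw [J.inner_op_left] at this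
    exact Complex.conj_eq_iff_im.1 this
  have him : (inner ℂ v ((z + z⁻¹) • v - J.op v)).im = (z + z⁻¹).im * ‖v‖ ^ 2 := by
    rw [inner_sub_right, inner_smul_right, Complex.sub_im, hreal, sub_zero,
      inner_self_eq_norm_sq_to_K]
    exact (congrArg Complex.im (by push_cast; rfl)).trans
      (Complex.im_mul_ofReal (z + z⁻¹) (‖v‖ ^ 2))
  have hle : |(z + z⁻¹).im| * ‖v‖ ^ 2 ≤ ‖ψ 0‖ * ‖v‖ := by
    calc _ = |(inner ℂ v ((z + z⁻¹) • v - J.op v)).im| := by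
          rw [him, abs_mul, abs_of_nonneg (sq_nonneg ‖v‖)]
      _ ≤ ‖inner ℂ v ((z + z⁻¹) • v - J.op v)‖ := Complex.abs_im_le_norm _
      _ ≤ ‖ψ 0‖ * (‖v‖ * ‖delta‖) := by
          rw [h1, norm_mul]; gcongr; exact norm_inner_le_norm _ _
      _ = _ := by
          rw [delta, lp.norm_single (by norm_num)]; simp
  have hv1 : ‖ψ 1‖ ≤ ‖v‖ := lp.norm_apply_le_norm two_ne_zero v 0
  rcases (norm_nonneg v).eq_or_lt with h0 | h0
  · rw [← h0] at hv1
    rw [le_antisymm hv1 (norm_nonneg _), mul_zero]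
    exact norm_nonneg _
  · have : |(z + z⁻¹).im| * ‖v‖ ≤ ‖ψ 0‖ := by
      refine le_of_mul_le_mul_right ?_ h0
      calc _ = |(z + z⁻¹).im| * ‖v‖ ^ 2 := by ring
        _ ≤ _ := hle
    exact (mul_le_mul_of_nonneg_left hv1 (abs_nonneg _)).trans this

end JacobiMatrix

/-! ### Compact perturbation of the free matrix and the M-function -/

namespace JacobiMatrix

/-- The free Jacobi matrix, `a_n = 1` and `b_n = 0`. -/
def free : JacobiMatrix where
  a := 1
  b := 0
  a_pos _ := one_pos
  bounded := ⟨1, by simp⟩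

theorem norm_sq_eq_tsum (w : L2) : ‖w‖ ^ 2 = ∑' n, ‖w n‖ ^ 2 := by
  have h := lp.norm_rpow_eq_tsum (p := 2) (by norm_num) w
  simpa using h

theorem norm_free_op_le : ‖free.op‖ ≤ 2 := by
  refine ContinuousLinearMap.opNorm_le_bound _ zero_le_two fun v => ?_
  refine le_of_sq_le_sq ?_ (by positivity)
  set g : ℕ → ℝ := fun n => match n with
    | 0 => 0
    | n + 1 => ‖v n‖ ^ 2 with hg
  have hv := summable_sq v
  have hv1 := (summable_nat_add_iff 1).2 hv
  have hgs : Summable g := (summable_nat_add_iff 1).1 hv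
  have hgt : ∑' n, g n = ‖v‖ ^ 2 := by
    rw [hgs.tsum_eq_zero_add, norm_sq_eq_tsum, hg]; simp
  have hle : ∑' n, ‖v (n + 1)‖ ^ 2 ≤ ‖v‖ ^ 2 := by
    rw [norm_sq_eq_tsum, hv.tsum_eq_zero_add]
    exact le_add_of_nonneg_left (sq_nonneg _)
  have hpt : ∀ n, ‖free.op v n‖ ^ 2 ≤ 2 * (g n + ‖v (n + 1)‖ ^ 2) := by
    intro n
    cases n with
    | zero =>
      simp only [op_apply, act, free, hg]
      simp
      nlinarith [sq_nonneg ‖v 1‖]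
    | succ n =>
      simp only [op_apply, act, free, hg]
      simp
      have h := norm_add_le (v n) (v (n + 2))
      have h0 := norm_nonneg (v n + v (n + 2))
      nlinarith [sq_nonneg (‖v n‖ - ‖v (n + 2)‖)]
  have := (summable_sq (free.op v)).tsum_le_tsum hpt ((hgs.add hv1).mul_left 2)
  rw [← norm_sq_eq_tsum, tsum_mul_left, hgs.tsum_add hv1, hgt] at this
  nlinarith

/-- The standard basis of `ℓ²`. -/
def basisVec (n : ℕ) : L2 := lp.single 2 n 1

theorem basisVec_apply (n m : ℕ) : basisVec n m = if m = n then 1 else 0 := by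
  rw [basisVec, lp.coeFn_single, Pi.single_apply]

theorem norm_basisVec (n : ℕ) : ‖basisVec n‖ = 1 := by
  rw [basisVec, lp.norm_single (by norm_num)]; simp

theorem inner_basisVec_left (n : ℕ) (v : L2) : inner ℂ (basisVec n) v = v n := by
  rw [basisVec, lp.inner_single_left]; simp

/-- The finite rank contribution of `b_n` and `a_n - 1` to `J - J₀`. -/
def rankTerm (J : JacobiMatrix) (n : ℕ) : L2 →L[ℂ] L2 :=
  (J.b n : ℂ) • InnerProductSpace.rankOne ℂ (basisVec n) (basisVec n) +
    ((J.a n - 1 : ℝ) : ℂ) • (InnerProductSpace.rankOne ℂ (basisVec n) (basisVec (n + 1)) +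
      InnerProductSpace.rankOne ℂ (basisVec (n + 1)) (basisVec n))

theorem norm_rankTerm_le (J : JacobiMatrix) (n : ℕ) :
    ‖J.rankTerm n‖ ≤ |J.b n| + 2 * |J.a n - 1| := by
  have h1 : ∀ i j, ‖InnerProductSpace.rankOne ℂ (basisVec i) (basisVec j)‖ = 1 := fun i j => by
    rw [InnerProductSpace.norm_rankOne, norm_basisVec, norm_basisVec, one_mul]
  refine (norm_add_le _ _).trans (add_le_add ?_ ?_)
  · rw [norm_smul, h1, Complex.norm_real, Real.norm_eq_abs, mul_one]
  · rw [norm_smul, Complex.norm_real, Real.norm_eq_abs, mul_comm]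
    refine mul_le_mul_of_nonneg_right ((norm_add_le _ _).trans ?_) (abs_nonneg _)
    rw [h1, h1]; norm_num

theorem rankTerm_apply (J : JacobiMatrix) (n : ℕ) (v : L2) (m : ℕ) :
    J.rankTerm n v m = (if m = n then J.b n * v n + (J.a n - 1) * v (n + 1) else 0) +
      if m = n + 1 then (J.a n - 1) * v n else 0 := by
  simp only [rankTerm, add_apply, smul_apply,
    InnerProductSpace.rankOne_apply, inner_basisVec_left, lp.coeFn_add, lp.coeFn_smul,
    Pi.add_apply, Pi.smul_apply, basisVec_apply, smul_eq_mul]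
  push_cast
  split_ifs <;> ring

theorem isCompactOperator_rankOne (x y : L2) :
    IsCompactOperator (InnerProductSpace.rankOne ℂ x y) := by
  rw [InnerProductSpace.rankOne_def']
  have h : IsCompactOperator (ContinuousLinearMap.toSpanSingleton ℂ x) :=
    isCompactOperator_of_locallyCompactSpace_rng _
  exact h.comp_clm _

theorem isCompactOperator_rankTerm (J : JacobiMatrix) (n : ℕ) :
    IsCompactOperator (J.rankTerm n) :=
  ((isCompactOperator_rankOne _ _).smul _).add
    (((isCompactOperator_rankOne _ _).add (isCompactOperator_rankOne _ _)).smul _)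

theorem hasSum_rankTerm (J : JacobiMatrix) (hs : Summable J.rankTerm) :
    HasSum J.rankTerm (J.op - free.op) := by
  have key : ∑' n, J.rankTerm n = J.op - free.op := by
    refine ContinuousLinearMap.ext fun v => lp.ext (funext fun m => ?_)
    have h1 : HasSum (fun n => J.rankTerm n v) ((∑' n, J.rankTerm n) v) :=
      hs.hasSum.mapL (ContinuousLinearMap.apply ℂ L2 v)
    have h2 : HasSum (fun n => J.rankTerm n v m) ((∑' n, J.rankTerm n) v m) := by
      have := h1.mapL (innerSL ℂ (basisVec m))
      simpa only [innerSL_apply_apply, inner_basisVec_left] using this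
    refine h2.unique ?_
    rw [sub_apply, lp.coeFn_sub, Pi.sub_apply, op_apply, op_apply]
    cases m with
    | zero =>
      convert hasSum_single (f := fun n => J.rankTerm n v 0) 0 ?_ using 1
      · rw [rankTerm_apply]; simp [act, free]; ring
      · intro n hn
        rw [rankTerm_apply]; simp [hn.symm]
    | succ m =>
      convert hasSum_sum_of_ne_finset_zero (f := fun n => J.rankTerm n v (m + 1))
        (s := {m, m + 1}) ?_ using 1
      · rw [Finset.sum_pair (by omega), rankTerm_apply, rankTerm_apply]
        simp [act, free]; ring
      · intro n hn
        simp only [Finset.mem_insert, Finset.mem_singleton, not_or] at hn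
        rw [rankTerm_apply, if_neg (by omega), if_neg (by omega), add_zero]
      · infer_instance
  rw [← key]; exact hs.hasSum

/-- The difference is a norm-convergent sum of finite rank operators. -/
theorem GeometricDecay.isCompactOperator_op_sub_free {J : JacobiMatrix} (hJ : J.GeometricDecay) :
    IsCompactOperator (J.op - free.op) := by
  obtain ⟨C, q, hq, hq1, hC⟩ := hJ
  have hs : Summable J.rankTerm := by
    refine .of_norm_bounded (((summable_geometric_of_lt_one hq.le hq1).mul_left C).mul_left 3)
      fun n => (J.norm_rankTerm_le n).trans ?_
    linarith [(hC n).1, (hC n).2]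
  have ht : Tendsto (fun s : Finset ℕ => ∑ n ∈ s, J.rankTerm n) atTop (𝓝 (J.op - free.op)) :=
    J.hasSum_rankTerm hs
  refine isCompactOperator_of_tendsto ht (Eventually.of_forall fun s => ?_)
  exact (Submodule.sum_mem (compactOperator (RingHom.id ℂ) L2 L2)
    (t := s) (f := fun n => J.rankTerm n)
    fun n _ => J.isCompactOperator_rankTerm n : _)

theorem abs_add_inv_gt_two {x : ℝ} (hx : x ≠ 0) (hx1 : |x| < 1) : 2 < |x + x⁻¹| := by
  have h : |x + x⁻¹| = |x| + |x|⁻¹ := by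
    rcases hx.lt_or_gt with h | h
    · rw [abs_of_neg h, abs_of_neg (add_neg h (inv_lt_zero.2 h)), inv_neg]; ring
    · rw [abs_of_pos h, abs_of_pos (by positivity)]
  rw [h]
  have hp : 0 < |x| := abs_pos.2 hx
  have : 0 < (1 - |x|) ^ 2 * |x|⁻¹ := by
    have : 0 < 1 - |x| := by linarith
    positivity
  have e : (1 - |x|) ^ 2 * |x|⁻¹ = |x| + |x|⁻¹ - 2 := by field_simp; ring
  linarith

theorem im_add_inv (z : ℂ) : (z + z⁻¹).im = z.im * (1 - (Complex.normSq z)⁻¹) := by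
  rw [Complex.add_im, Complex.inv_im]; ring

theorem im_add_inv_eq_zero_iff {z : ℂ} (hz : z ≠ 0) (hz1 : ‖z‖ < 1) :
    (z + z⁻¹).im = 0 ↔ z.im = 0 := by
  rw [im_add_inv, mul_eq_zero, or_iff_left]
  intro h
  have h1 : Complex.normSq z < 1 := by
    rw [Complex.normSq_eq_norm_sq]; exact pow_lt_one₀ (norm_nonneg z) hz1 two_ne_zero
  have := (one_lt_inv₀ (Complex.normSq_pos.2 hz)).2 h1
  linarith

variable {J : JacobiMatrix} {z : ℂ} {ψ : ℕ → ℂ}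

/-- The sequence `(0, v_0, v_1, …)`. -/
def consZero (v : ℕ → ℂ) : ℕ → ℂ
  | 0 => 0
  | n + 1 => v n

theorem solves_consZero {E : ℂ} {v : L2} (hv : J.op v = E • v) :
    J.Solves E (consZero v) := by
  intro n
  have h : J.op v n = E * v n := by rw [hv]; rfl
  rw [op_apply] at h
  cases n with
  | zero => simpa [act, offDiag, consZero] using h
  | succ n => simpa [act, offDiag, consZero] using h

/-- Extended by 0 at index 0, an eigenvector has vanishing Wronskian with ψ; at n = 0 this reads v_0
ψ_0 = 0, so two consecutive entries are zero. -/
theorem IsJostSolution.eq_zero_of_op_eq (h : J.IsJostSolution z ψ) (hz : z ≠ 0) (hz1 : ‖z‖ < 1)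
    (h0 : ψ 0 ≠ 0) {v : L2} (hv : J.op v = (z + z⁻¹) • v) : v = 0 := by
  have hs := solves_consZero hv
  have ht : Tendsto (consZero v) atTop (𝓝 0) := by
    rw [← tendsto_add_atTop_iff_nat 1]
    have := (summable_sq v).tendsto_atTop_zero.sqrt
    simp only [Real.sqrt_sq (norm_nonneg _), Real.sqrt_zero] at this
    exact tendsto_zero_iff_norm_tendsto_zero.2 this
  have hw := hs.wronskian_eq_zero h.solves ht (h.tendsto_zero hz hz1) 0
  have hv0 : v 0 = 0 := by
    simpa [wronskian, offDiag, consZero, h0] using hw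
  have := hs.eq_zero_of_two rfl hv0
  exact lp.ext (funext fun n => congrFun this (n + 1))

/-- Nonreal energies are covered by self-adjointness. A real one has |E| > 2, outside the free
spectrum, and the Fredholm alternative leaves only an eigenvalue, which ψ_0 ≠ 0 excludes. -/
theorem GeometricDecay.mem_resolventSet (hJ : J.GeometricDecay) (h : J.IsJostSolution z ψ) (hz : z ≠ 0)
    (hz1 : ‖z‖ < 1) (h0 : ψ 0 ≠ 0) : z + z⁻¹ ∈ resolventSet ℂ J.op := by
  by_cases him : (z + z⁻¹).im = 0
  swap
  · by_contra hn
    have := J.isSelfAdjoint_op.mem_spectrum_eq_re (z := z + z⁻¹) hn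
    exact him (by rw [this, Complex.ofReal_im])
  have hzr : z = (z.re : ℂ) := by
    rw [im_add_inv_eq_zero_iff hz hz1] at him
    exact Complex.ext rfl (by simpa using him)
  have hE : z + z⁻¹ ∈ resolventSet ℂ free.op := by
    refine spectrum.mem_resolventSet_of_norm_lt_mul ((mul_le_mul norm_free_op_le
      ContinuousLinearMap.norm_id_le (norm_nonneg _) zero_le_two).trans_lt ?_)
    rw [mul_one]
    have h1 : z.re ≠ 0 := fun h => hz (by rw [hzr, h, Complex.ofReal_zero])
    have h2 : |z.re| < 1 := by rwa [hzr, Complex.norm_real, Real.norm_eq_abs] at hz1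
    rw [hzr, ← Complex.ofReal_inv, ← Complex.ofReal_add, Complex.norm_real, Real.norm_eq_abs]
    exact abs_add_inv_gt_two h1 h2
  obtain ⟨A, hA⟩ := spectrum.mem_resolventSet_iff.1 hE
  have hc : IsCompactOperator ((↑A⁻¹ : L2 →L[ℂ] L2) * (J.op - free.op)) :=
    hJ.isCompactOperator_op_sub_free.clm_comp (↑A⁻¹ : L2 →L[ℂ] L2)
  have hfac : algebraMap ℂ (L2 →L[ℂ] L2) (z + z⁻¹) - J.op =
      ↑A * (1 - (↑A⁻¹ : L2 →L[ℂ] L2) * (J.op - free.op)) := by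
    rw [mul_sub, mul_one, ← mul_assoc, Units.mul_inv, one_mul, hA]; abel
  rw [spectrum.mem_resolventSet_iff, hfac]
  refine A.isUnit.mul ?_
  rcases hc.hasEigenvalue_or_mem_resolventSet one_ne_zero with h1 | h1
  · exfalso
    obtain ⟨v, hv⟩ := h1.exists_hasEigenvector
    refine hv.2 (h.eq_zero_of_op_eq hz hz1 h0 ?_)
    have h2 : ((↑A⁻¹ : L2 →L[ℂ] L2) * (J.op - free.op)) v = v := by
      simpa using hv.apply_eq_smul
    have h3 : (algebraMap ℂ (L2 →L[ℂ] L2) (z + z⁻¹) - J.op) v = 0 := by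
      rw [hfac, mul_apply_eq_comp, sub_apply, h2]; simp
    rw [sub_apply, Algebra.algebraMap_eq_smul_one] at h3
    exact (sub_eq_zero.1 h3).symm
  · simpa using spectrum.mem_resolventSet_iff.1 h1

/-- The resolvent sends ψ_0 δ_1 to (ψ_1, ψ_2, …), whose first entry is ψ_1. -/
theorem GeometricDecay.M_eq (hJ : J.GeometricDecay) (h : J.IsJostSolution z ψ) (hz : z ≠ 0)
    (hz1 : ‖z‖ < 1) (h0 : ψ 0 ≠ 0) : J.M z = ψ 1 / ψ 0 := by
  have hr := hJ.mem_resolventSet h hz hz1 h0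
  have e : (algebraMap ℂ (L2 →L[ℂ] L2) (z + z⁻¹) - J.op) (h.vec hz hz1) = ψ 0 • delta := by
    rw [← h.sub_op_vec hz hz1, sub_apply, Algebra.algebraMap_eq_smul_one]
    rfl
  have e2 : resolvent J.op (z + z⁻¹) (ψ 0 • delta) = h.vec hz hz1 := by
    rw [← e, ← mul_apply_eq_comp, resolvent, Ring.inverse_mul_cancel _ hr]; rfl
  have e3 : resolvent J.op (z + z⁻¹) delta = (ψ 0)⁻¹ • h.vec hz hz1 := by
    rw [← e2, map_smul, inv_smul_smul₀ h0]
  rw [M, e3, inner_smul_right, inner_delta_left, h.vec_apply]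
  field_simp

end JacobiMatrix

/-! ### Zeros of the Jost function and the noncanonical condition -/

namespace JacobiMatrix

variable {J : JacobiMatrix} {R : ℝ} {f : ℕ → ℂ → ℂ} {z : ℂ}

theorem GeometricDecay.tendsto_offDiag (hJ : J.GeometricDecay) :
    Tendsto (fun n => (J.offDiag n : ℂ)) atTop (𝓝 1) := by
  obtain ⟨C, q, hq, hq1, hC⟩ := hJ
  have h : Tendsto J.a atTop (𝓝 1) := by
    rw [tendsto_iff_norm_sub_tendsto_zero]
    refine squeeze_zero (fun _ => norm_nonneg _) (fun n => (hC n).2) ?_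
    simpa using (tendsto_pow_atTop_nhds_zero_of_lt_one hq.le hq1).const_mul C
  have h' : Tendsto J.offDiag atTop (𝓝 1) := (tendsto_add_atTop_iff_nat 1).1 h
  exact_mod_cast (Complex.continuous_ofReal.tendsto 1).comp h'

namespace IsJostFamily

theorem analyticAt (h : J.IsJostFamily R f) (n : ℕ) (hz : ‖z‖ < R) : AnalyticAt ℂ (f n) z :=
  (h.differentiableOn n).analyticAt (Metric.isOpen_ball.mem_nhds (by simpa using hz))

/-- At z = 0 the recurrence is a_n f_n = f_{n+1}, so a zero would propagate against f_n → 1. This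
keeps the convention 0⁻¹ = 0 out of `P₂`. -/
theorem zero_apply_zero_ne (h : J.IsJostFamily R f) : f 0 0 ≠ 0 := by
  intro h0
  have hR : (0 : ℂ) ∈ Metric.ball (0 : ℂ) R := Metric.mem_ball_self (one_pos.trans h.one_lt)
  have hall : ∀ n, f n 0 = 0 := by
    intro n
    induction n with
    | zero => exact h0
    | succ n ih => simpa [ih] using (h.recurrence n 0 hR).symm
  have := h.tendsto_one 0 hR
  simp only [hall] at this
  exact zero_ne_one (tendsto_nhds_unique tendsto_const_nhds this)

theorem one_ne_zero_of_zero (h : J.IsJostFamily R f) (hz : z ≠ 0) (hz1 : ‖z‖ < 1)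
    (h0 : f 0 z = 0) : f 1 z ≠ 0 := fun h1 =>
  (h.isJostSolution hz hz1).ne_zero
    ((h.isJostSolution hz hz1).solves.eq_zero_of_two (by simp [h0]) (by simp [h1]))

theorem im_eq_zero_of_zero (h : J.IsJostFamily R f) (hz : z ≠ 0) (hz1 : ‖z‖ < 1)
    (h0 : f 0 z = 0) : z.im = 0 := by
  have h1 := (h.isJostSolution hz hz1).abs_im_mul_norm_le hz hz1
  rw [h0, mul_zero, norm_zero] at h1
  have h2 : 0 < ‖z ^ 1 * f 1 z‖ :=
    norm_pos_iff.2 (mul_ne_zero (pow_ne_zero 1 hz) (h.one_ne_zero_of_zero hz hz1 h0))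
  rw [← im_add_inv_eq_zero_iff hz hz1, ← abs_nonpos_iff]
  exact nonpos_of_mul_nonpos_left h1 h2

/-- The zeros of the Jost function in the unit disk are simple. -/
theorem deriv_ne_zero_of_zero (h : J.IsJostFamily R f) (hz : z ≠ 0) (hz1 : ‖z‖ < 1)
    (h0 : f 0 z = 0) : deriv (f 0) z ≠ 0 := by
  have him := h.im_eq_zero_of_zero hz hz1 h0
  have hzR := hz1.trans h.one_lt
  have hd := (h.analyticAt 0 hzR).differentiableAt.hasDerivAt.tendsto_slope
  have hcont : ContinuousAt (f 1) z := (h.analyticAt 1 hzR).continuousAt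
  -- The real zero is approached vertically. There |Im(ζ + 1/ζ)| = ε(|ζ|⁻² - 1), so the self-adjoint
  -- bound keeps the difference quotient of f_0 away from 0.
  set ζ : ℝ → ℂ := fun ε => z + ε * Complex.I with hζ
  have hζc : Continuous ζ := by fun_prop
  have hζ0 : ζ 0 = z := by simp [hζ]
  have htend : Tendsto ζ (𝓝[>] 0) (𝓝 z) := by
    have := hζc.tendsto 0
    rw [hζ0] at this
    exact this.mono_left nhdsWithin_le_nhds
  have htend' : Tendsto ζ (𝓝[>] 0) (𝓝[≠] z) := by
    refine tendsto_nhdsWithin_iff.2 ⟨htend, ?_⟩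
    filter_upwards [self_mem_nhdsWithin] with ε hε
    simpa [hζ] using (ne_of_gt hε : ε ≠ 0)
  have hsl := (hd.comp htend').norm
  have hlow : Tendsto (fun ε => ((Complex.normSq (ζ ε))⁻¹ - 1) * ‖ζ ε * f 1 (ζ ε)‖) (𝓝[>] 0)
      (𝓝 (((Complex.normSq z)⁻¹ - 1) * ‖z * f 1 z‖)) := by
    refine Tendsto.mul (Tendsto.sub_const (Tendsto.inv₀ ?_ ?_) 1) (Tendsto.norm ?_)
    · exact (Complex.continuous_normSq.tendsto z).comp htend
    · exact (Complex.normSq_pos.2 hz).ne'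
    · exact htend.mul (hcont.tendsto.comp htend)
  have hle := le_of_tendsto_of_tendsto hlow hsl ?_
  · have hn : Complex.normSq z < 1 := by
      rw [Complex.normSq_eq_norm_sq]; exact pow_lt_one₀ (norm_nonneg z) hz1 two_ne_zero
    have h1 := (one_lt_inv₀ (Complex.normSq_pos.2 hz)).2 hn
    have h2 : 0 < ‖z * f 1 z‖ :=
      norm_pos_iff.2 (mul_ne_zero hz (h.one_ne_zero_of_zero hz hz1 h0))
    have h3 : 0 < ‖deriv (f 0) z‖ := (mul_pos (by linarith) h2).trans_le hle
    exact norm_pos_iff.1 h3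
  · have e1 := htend.eventually_ne hz
    have e2 := htend.norm.eventually_lt_const hz1
    filter_upwards [e1, e2, self_mem_nhdsWithin] with ε h1 h2 (hε : 0 < ε)
    have hb := (h.isJostSolution h1 h2).abs_im_mul_norm_le h1 h2
    have hi : (ζ ε).im = ε := by simp [hζ, him]
    have hsub : ‖ζ ε - z‖ = ε := by simp [hζ, abs_of_pos hε]
    rw [im_add_inv, hi, abs_mul, abs_of_pos hε, pow_one, pow_zero, one_mul] at hb
    rw [Function.comp_apply, slope_def_field, h0, sub_zero, norm_div, hsub, le_div_iff₀ hε]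
    refine le_trans ?_ hb
    have hab : (Complex.normSq (ζ ε))⁻¹ - 1 ≤ |1 - (Complex.normSq (ζ ε))⁻¹| := by
      rw [abs_sub_comm]; exact le_abs_self _
    calc _ = ε * ((Complex.normSq (ζ ε))⁻¹ - 1) * ‖ζ ε * f 1 (ζ ε)‖ := by ring
      _ ≤ _ := by gcongr

theorem eventually_ne_zero (h : J.IsJostFamily R f) (hz : z ≠ 0) (hz1 : ‖z‖ < 1) :
    ∀ᶠ ζ in 𝓝[≠] z, f 0 ζ ≠ 0 := by
  have ha := h.analyticAt 0 (hz1.trans h.one_lt)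
  by_cases h0 : f 0 z = 0
  · have := ha.differentiableAt.hasDerivAt.eventually_ne (c := 0)
      (h.deriv_ne_zero_of_zero hz hz1 h0)
    exact this
  · exact (ha.continuousAt.eventually_ne h0).filter_mono nhdsWithin_le_nhds

theorem tendsto_mul_M (h : J.IsJostFamily R f) (hJ : J.GeometricDecay) (hz : z ≠ 0)
    (hz1 : ‖z‖ < 1) (h0 : f 0 z = 0) : Tendsto (fun ζ => (ζ - z) * J.M ζ) (𝓝[≠] z)
      (𝓝 (z * f 1 z / deriv (f 0) z)) := by
  have hzR := hz1.trans h.one_lt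
  have hd := (h.analyticAt 0 hzR).differentiableAt.hasDerivAt.tendsto_slope
  have hcont : Tendsto (fun ζ => ζ * f 1 ζ) (𝓝[≠] z) (𝓝 (z * f 1 z)) :=
    (continuousAt_id.mul (h.analyticAt 1 hzR).continuousAt).tendsto.mono_left nhdsWithin_le_nhds
  refine (hcont.div hd (h.deriv_ne_zero_of_zero hz hz1 h0)).congr' ?_
  have e1 : ∀ᶠ ζ in 𝓝[≠] z, ζ ≠ 0 :=
    (continuousAt_id.eventually_ne hz).filter_mono nhdsWithin_le_nhds
  have e2 : ∀ᶠ ζ in 𝓝[≠] z, ‖ζ‖ < 1 :=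
    (continuous_norm.continuousAt.eventually_lt_const hz1).filter_mono nhdsWithin_le_nhds
  filter_upwards [e1, e2, h.eventually_ne_zero hz hz1, self_mem_nhdsWithin] with ζ h1 h2 h3 h4
  have h5 : ζ - z ≠ 0 := sub_ne_zero.2 h4
  have hM := hJ.M_eq (h.isJostSolution h1 h2) h1 h2 (by simpa using h3)
  rw [hM, Pi.div_apply, slope_def_field, h0, sub_zero]
  simp only [pow_one, pow_zero, one_mul]
  field_simp

/-- The Wronskian identity relating `z` and `1/z` near the unit circle. -/
theorem mul_sub_mul_inv (h : J.IsJostFamily R f) (hJ : J.GeometricDecay) (hz : z ≠ 0)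
    (hzR : ‖z‖ < R) (hzR' : ‖z⁻¹‖ < R) :
    z * f 1 z * f 0 z⁻¹ - f 0 z * (z⁻¹ * f 1 z⁻¹) = z - z⁻¹ := by
  have s1 := h.solves hz hzR
  have s2 := h.solves (inv_ne_zero hz) hzR'
  rw [inv_inv, add_comm] at s2
  have hc := s1.wronskian_eq s2
  have t1 := h.tendsto_one z (by simpa using hzR)
  have t2 := h.tendsto_one z⁻¹ (by simpa using hzR')
  have t1' := (tendsto_add_atTop_iff_nat 1).2 t1
  have t2' := (tendsto_add_atTop_iff_nat 1).2 t2
  -- The constant Wronskian is evaluated at infinity, where a_n and f_n tend to 1.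
  have ht := hJ.tendsto_offDiag.mul (((t1.mul t2').const_mul z⁻¹).sub ((t1'.mul t2).const_mul z))
  have e : ∀ n, (J.offDiag n : ℂ) * (z⁻¹ * (f n z * f (n + 1) z⁻¹) -
      z * (f (n + 1) z * f n z⁻¹)) = J.wronskian (fun n => z ^ n * f n z)
        (fun n => z⁻¹ ^ n * f n z⁻¹) 0 := by
    intro n
    rw [← hc n, wronskian]
    simp only [inv_pow, pow_succ]
    field_simp
  simp only [e] at ht
  have := tendsto_nhds_unique tendsto_const_nhds ht
  simp only [wronskian, offDiag, pow_zero, one_mul, zero_add, pow_one, mul_one,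
    Complex.ofReal_one] at this
  linear_combination -this

/-- Inserting the residue z f_1/f_0' and clearing denominators removes u'. The case u(1/z) = 0 needs
no exception any more, since then the expression is z⁻¹ - z ≠ 0. -/
theorem isNoncanonicalZero_iff (h : J.IsJostFamily R f) (hJ : J.GeometricDecay) {u : ℂ → ℂ}
    (hu : ∀ ζ, ‖ζ‖ < R → u ζ = f 0 ζ) (z : ℂ) :
    J.IsNoncanonicalZero u z ↔ ‖z‖ < 1 ∧ z ≠ 0 ∧ f 0 z = 0 ∧ ¬ IsPole u z⁻¹ ∧
      z⁻¹ - z + u z⁻¹ * (z * f 1 z) ≠ 0 := by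
  by_cases hz1 : ‖z‖ < 1
  swap
  · exact ⟨fun H => absurd H.mem_disk hz1, fun H => absurd H.1 hz1⟩
  have hzR := hz1.trans h.one_lt
  by_cases h0 : f 0 z = 0
  swap
  · exact ⟨fun H => absurd ((hu z hzR).symm.trans H.zero) h0, fun H => absurd H.2.2.1 h0⟩
  have hz : z ≠ 0 := by rintro rfl; exact h.zero_apply_zero_ne h0
  have hd := h.deriv_ne_zero_of_zero hz hz1 h0
  have hder : deriv u z = deriv (f 0) z := by
    refine Filter.EventuallyEq.deriv_eq ?_
    filter_upwards [continuous_norm.continuousAt.eventually_lt_const hzR] with ζ hζ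
    exact hu ζ hζ
  have hne : z⁻¹ - z ≠ 0 := by
    rw [sub_ne_zero]
    intro e
    have h1 : ‖z⁻¹‖ = ‖z‖ := by rw [e]
    rw [norm_inv] at h1
    have h2 := (one_lt_inv₀ (norm_pos_iff.2 hz)).2 hz1
    linarith
  have ht := h.tendsto_mul_M hJ hz hz1 h0
  have hcan : u z⁻¹ ≠ 0 → (z * f 1 z / deriv (f 0) z ≠ (z - z⁻¹) * (deriv u z * u z⁻¹)⁻¹ ↔
      z⁻¹ - z + u z⁻¹ * (z * f 1 z) ≠ 0) := by
    intro huz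
    rw [hder, ← div_eq_mul_inv, Ne, Ne, not_iff_not, div_eq_div_iff hd (mul_ne_zero hd huz)]
    constructor
    · intro e
      refine mul_left_cancel₀ hd ?_
      linear_combination e
    · intro e
      linear_combination deriv (f 0) z * e
  constructor
  · intro H
    refine ⟨hz1, hz, h0, H.not_pole, ?_⟩
    by_cases huz : u z⁻¹ = 0
    · rw [huz, zero_mul, add_zero]; exact hne
    · obtain ⟨L, hL, hLne⟩ := H.weight.resolve_left huz
      rw [tendsto_nhds_unique hL ht] at hLne
      exact (hcan huz).1 hLne
  · rintro ⟨-, -, -, hp, hc⟩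
    refine ⟨hz1, (hu z hzR).trans h0, hp, ?_⟩
    by_cases huz : u z⁻¹ = 0
    · exact Or.inl huz
    · exact Or.inr ⟨_, ht, (hcan huz).2 hc⟩

end IsJostFamily

end JacobiMatrix

/-! ### Continuation of the Wronskian relation and transfer of singular points -/

namespace JacobiMatrix

theorem _root_.MeromorphicOn.eventuallyEq_of_isPreconnected {F G : ℂ → ℂ} {U : Set ℂ}
    (hF : MeromorphicOn F U) (hG : MeromorphicOn G U) (hU : IsPreconnected U) {x y : ℂ}
    (hx : x ∈ U) (hy : y ∈ U) (h : F =ᶠ[𝓝[≠] x] G) : F =ᶠ[𝓝[≠] y] G := by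
  have hFG : MeromorphicOn (F - G) U := hF.sub hG
  have hxt : meromorphicOrderAt (F - G) x = ⊤ := by
    rw [meromorphicOrderAt_eq_top_iff]
    filter_upwards [h] with t ht
    simp [ht]
  have hyt : meromorphicOrderAt (F - G) y = ⊤ := by
    by_contra hne
    exact hFG.meromorphicOrderAt_ne_top_of_isPreconnected hU hy hx hne hxt
  rw [meromorphicOrderAt_eq_top_iff] at hyt
  filter_upwards [hyt] with t ht
  exact sub_eq_zero.1 ht

theorem not_isPole_iff {u : ℂ → ℂ} {w : ℂ} (hu : MeromorphicNFAt u w) :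
    ¬ IsPole u w ↔ AnalyticAt ℂ u w := by
  rw [IsPole, not_lt, hu.meromorphicOrderAt_nonneg_iff_analyticAt]

/-- Transfer of singular points along a relation `p V = c + q U` whose coefficient `q` has at most
a simple zero. -/
theorem isPole_or_of_relation {U V p q c : ℂ → ℂ} {w : ℂ} (hU : MeromorphicNFAt U w)
    (hV : MeromorphicNFAt V w) (hp : AnalyticAt ℂ p w) (hq : AnalyticAt ℂ q w)
    (hc : AnalyticAt ℂ c w) (hrel : ∀ᶠ t in 𝓝[≠] w, p t * V t = c t + q t * U t)
    (hq1 : q w = 0 → deriv q w ≠ 0)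
    (H : IsPole U w ∨ p w = 0 ∧ ¬ IsPole U w ∧ c w + q w * U w ≠ 0) :
    IsPole V w ∨ q w = 0 ∧ ¬ IsPole V w ∧ p w * V w - c w ≠ 0 := by
  by_cases hVp : IsPole V w
  · exact Or.inl hVp
  have hVa := (not_isPole_iff hV).1 hVp
  rcases H with hUp | ⟨hpw, hUp, hne⟩
  -- Now q U = p V - c is analytic although U has a pole, which forces q(w) = 0. If p V - c vanished
  -- at w too, U would tend to the quotient of the derivatives.
  · refine Or.inr ?_
    have hg : AnalyticAt ℂ (fun t => p t * V t - c t) w := (hp.mul hVa).sub hc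
    have hUnot : ∀ L, ¬ Tendsto U (𝓝[≠] w) (𝓝 L) := fun L hL =>
      not_le.2 hUp ((tendsto_nhds_iff_meromorphicOrderAt_nonneg hU.meromorphicAt).1 ⟨L, hL⟩)
    have hqw : q w = 0 := by
      by_contra hqw
      have t1 := (hg.continuousAt.tendsto.div hq.continuousAt.tendsto hqw).mono_left
        (nhdsWithin_le_nhds (s := {w}ᶜ))
      refine hUnot _ (t1.congr' ?_)
      filter_upwards [hrel, (hq.continuousAt.eventually_ne hqw).filter_mono nhdsWithin_le_nhds]
        with t h1 h2
      rw [Pi.div_apply, h1, add_sub_cancel_left, mul_div_cancel_left₀ _ h2]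
    refine ⟨hqw, hVp, fun hgw => ?_⟩
    have t1 := hg.differentiableAt.hasDerivAt.tendsto_slope
    have t2 := hq.differentiableAt.hasDerivAt.tendsto_slope
    refine hUnot _ ((t1.div t2 (hq1 hqw)).congr' ?_)
    filter_upwards [hrel, hq.differentiableAt.hasDerivAt.eventually_ne (c := 0) (hq1 hqw),
      self_mem_nhdsWithin] with t h1 h2 h3
    have h4 : t - w ≠ 0 := sub_ne_zero.2 h3
    rw [Pi.div_apply, slope_def_field, slope_def_field, hgw, hqw, h1, sub_zero, sub_zero,
      add_sub_cancel_left]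
    field_simp
  -- With U and V both analytic, p(w) = 0 would give c + qU = 0 at w.
  · exfalso
    have hUa := (not_isPole_iff hU).1 hUp
    have t1 : Tendsto (fun t => p t * V t) (𝓝[≠] w) (𝓝 (p w * V w)) :=
      (hp.mul hVa).continuousAt.tendsto.mono_left nhdsWithin_le_nhds
    have t2 : Tendsto (fun t => c t + q t * U t) (𝓝[≠] w) (𝓝 (c w + q w * U w)) :=
      (hc.add (hq.mul hUa)).continuousAt.tendsto.mono_left nhdsWithin_le_nhds
    have := tendsto_nhds_unique (t1.congr' hrel) t2
    rw [hpw, zero_mul] at this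
    exact hne this.symm

variable {J : JacobiMatrix} {R : ℝ} {f : ℕ → ℂ → ℂ} {u u₁ : ℂ → ℂ}

theorem IsEntireMeromorphicJost.eq_family (hu : J.IsEntireMeromorphicJost u)
    (h : J.IsJostFamily R f) (z : ℂ) (hz : ‖z‖ < R) : u z = f 0 z := by
  have hzb : z ∈ Metric.ball (0 : ℂ) R := by simpa using hz
  have hfa : AnalyticOnNhd ℂ (f 0) (Metric.ball 0 R) := fun x hx =>
    h.analyticAt 0 (by simpa using hx)
  -- Any point of the punctured unit disk would serve as the base of the identity theorem. Normal
  -- form then upgrades equality on punctured neighbourhoods to equality at every point.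
  have hhalf : (2⁻¹ : ℂ) ∈ Metric.ball (0 : ℂ) R := by
    have := h.one_lt
    simp; linarith
  have hev : u =ᶠ[𝓝[≠] (2⁻¹ : ℂ)] f 0 := by
    refine EventuallyEq.filter_mono ?_ nhdsWithin_le_nhds
    have e1 : ∀ᶠ ζ : ℂ in 𝓝 2⁻¹, ζ ≠ 0 := continuousAt_id.eventually_ne (by simp)
    have e2 : ∀ᶠ ζ : ℂ in 𝓝 2⁻¹, ‖ζ‖ < 1 :=
      continuous_norm.continuousAt.eventually_lt_const (by simp; norm_num)
    filter_upwards [e1, e2] with ζ h1 h2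
    obtain ⟨ψ, hψ, hψ0⟩ := hu.jost ζ (norm_pos_iff.2 h1) h2
    rw [hψ0, hψ.unique (h.isJostSolution h1 h2) h1 h2]
    simp
  have := MeromorphicOn.eventuallyEq_of_isPreconnected
    (fun x _ => (hu.meromorphic (Set.mem_univ x)).meromorphicAt)
    (fun x hx => (hfa x hx).meromorphicAt) (convex_ball (0 : ℂ) R).isPreconnected hhalf hzb hev
  exact (((hu.meromorphic (Set.mem_univ z)).eventuallyEq_nhdsNE_iff_eventuallyEq_nhds
    (hfa z hzb).meromorphicNFAt).1 this).self_of_nhds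

theorem IsEntireMeromorphicJost.analyticAt (hu : J.IsEntireMeromorphicJost u)
    (h : J.IsJostFamily R f) {z : ℂ} (hz : ‖z‖ < R) : AnalyticAt ℂ u z := by
  refine (h.analyticAt 0 hz).congr ?_
  filter_upwards [continuous_norm.continuousAt.eventually_lt_const hz] with ζ hζ
  exact (hu.eq_family h ζ hζ).symm

theorem IsEntireMeromorphicJost.meromorphicNFAt (hu : J.IsEntireMeromorphicJost u) (z : ℂ) :
    MeromorphicNFAt u z := hu.meromorphic (Set.mem_univ z)

/-- This brings membership, up to the factors w and a_1, into the form of the hypothesis `H` of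
`isPole_or_of_relation`. Poles satisfy |w| > 1 because u is analytic on |z| < R. -/
theorem IsEntireMeromorphicJost.mem_P_iff (hu : J.IsEntireMeromorphicJost u)
    (h : J.IsJostFamily R f) (hJ : J.GeometricDecay) (w : ℂ) :
    w ∈ J.P u ↔ 1 < ‖w‖ ∧ (IsPole u w ∨ f 0 w⁻¹ = 0 ∧ ¬ IsPole u w ∧
      w - w⁻¹ + u w * (w⁻¹ * f 1 w⁻¹) ≠ 0) := by
  have hP2 : w ∈ J.P₂ u ↔ J.IsNoncanonicalZero u w⁻¹ := by
    constructor
    · rintro ⟨z, hz, rfl⟩; rwa [inv_inv]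
    · exact fun H => ⟨w⁻¹, H, (inv_inv w).symm⟩
  have hP1 : IsPole u w → 1 < ‖w‖ := by
    intro hp
    by_contra hw
    exact (not_isPole_iff (hu.meromorphicNFAt w)).2
      (hu.analyticAt h ((not_lt.1 hw).trans_lt h.one_lt)) hp
  have hinv : ‖w⁻¹‖ < 1 ∧ w⁻¹ ≠ 0 ↔ 1 < ‖w‖ := by
    rw [norm_inv, Ne, inv_eq_zero]
    constructor
    · rintro ⟨h1, h2⟩
      exact (inv_lt_one₀ (norm_pos_iff.2 h2)).1 h1
    · intro h1
      exact ⟨inv_lt_one_of_one_lt₀ h1, norm_pos_iff.1 (one_pos.trans h1)⟩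
  rw [P, Set.mem_union, hP2, h.isNoncanonicalZero_iff hJ (hu.eq_family h), ← and_assoc, hinv,
    inv_inv]
  have : w ∈ P₁ u ↔ IsPole u w := Iff.rfl
  tauto

/-- The relation between the two continued Jost functions. -/
theorem IsEntireMeromorphicJost.eventually_relation (hu : J.IsEntireMeromorphicJost u)
    (hu₁ : J.strip.IsEntireMeromorphicJost u₁) (h : J.IsJostFamily R f) (hJ : J.GeometricDecay)
    {w : ℂ} (hw : 1 < ‖w‖) : ∀ᶠ t in 𝓝[≠] w, t * f 0 t⁻¹ * u₁ t =
      J.a 0 * (t - t⁻¹) + J.a 0 * (t⁻¹ * f 1 t⁻¹) * u t := by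
  have hf := hu.eq_family h
  have hf₁ : ∀ ζ, ‖ζ‖ < R → u₁ ζ = J.a 0 * f 1 ζ := hu₁.eq_family h.strip
  have hw0 : w ≠ 0 := norm_pos_iff.1 (one_pos.trans hw)
  have hm : ∀ v : ℂ → ℂ, (∀ x, MeromorphicNFAt v x) →
      MeromorphicOn (fun t => v t⁻¹) {(0 : ℂ)}ᶜ := fun v hv x hx =>
    (hv x⁻¹).meromorphicAt.comp_analyticAt (analyticAt_inv hx)
  have hm' : ∀ v : ℂ → ℂ, (∀ x, MeromorphicNFAt v x) → MeromorphicOn v {(0 : ℂ)}ᶜ :=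
    fun v hv x _ => (hv x).meromorphicAt
  have hid : MeromorphicOn (fun t : ℂ => t) {(0 : ℂ)}ᶜ := fun x _ => analyticAt_id.meromorphicAt
  have hin : MeromorphicOn (fun t : ℂ => t⁻¹) {(0 : ℂ)}ᶜ := fun x hx =>
    (analyticAt_inv hx).meromorphicAt
  have hco : MeromorphicOn (fun _ : ℂ => (J.a 0 : ℂ)) {(0 : ℂ)}ᶜ := fun x _ =>
    analyticAt_const.meromorphicAt
  have hF : MeromorphicOn (fun t => t * u t⁻¹ * u₁ t) {(0 : ℂ)}ᶜ :=
    (hid.mul (hm u hu.meromorphicNFAt)).mul (hm' u₁ hu₁.meromorphicNFAt)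
  have hG : MeromorphicOn (fun t => J.a 0 * (t - t⁻¹) + t⁻¹ * u₁ t⁻¹ * u t) {(0 : ℂ)}ᶜ :=
    (hco.mul (hid.sub hin)).add
      ((hin.mul (hm u₁ hu₁.meromorphicNFAt)).mul (hm' u hu.meromorphicNFAt))
  -- Near 1 both t and 1/t lie in the disk of radius R, so the Wronskian identity applies. It
  -- spreads over the connected set ℂ ∖ {0}, where u(1/t) and u₁(1/t) are meromorphic.
  have hone : (fun t => t * u t⁻¹ * u₁ t) =ᶠ[𝓝[≠] (1 : ℂ)]
      fun t => J.a 0 * (t - t⁻¹) + t⁻¹ * u₁ t⁻¹ * u t := by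
    refine EventuallyEq.filter_mono ?_ nhdsWithin_le_nhds
    have e1 : ∀ᶠ t : ℂ in 𝓝 1, t ≠ 0 := continuousAt_id.eventually_ne one_ne_zero
    have e2 : ∀ᶠ t : ℂ in 𝓝 1, ‖t‖ < R :=
      continuous_norm.continuousAt.eventually_lt_const (by simpa using h.one_lt)
    have e3 : ∀ᶠ t : ℂ in 𝓝 1, ‖t⁻¹‖ < R :=
      (continuousAt_inv₀ one_ne_zero).norm.eventually_lt_const (by simpa using h.one_lt)
    filter_upwards [e1, e2, e3] with t h1 h2 h3
    have := h.mul_sub_mul_inv hJ h1 h2 h3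
    rw [hf t h2, hf _ h3, hf₁ t h2, hf₁ _ h3]
    linear_combination (J.a 0 : ℂ) * this
  have hpre : IsPreconnected ({(0 : ℂ)}ᶜ : Set ℂ) :=
    (isConnected_compl_singleton_of_one_lt_rank
      (by rw [Complex.rank_real_complex]; norm_num) (0 : ℂ)).isPreconnected
  have hev := hF.eventuallyEq_of_isPreconnected hG hpre (by simp) (by simpa using hw0) hone
  have e4 : ∀ᶠ t : ℂ in 𝓝[≠] w, ‖t⁻¹‖ < R := by
    refine ((continuousAt_inv₀ hw0).norm.eventually_lt_const ?_).filter_mono nhdsWithin_le_nhds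
    simp only [norm_inv]
    exact (inv_lt_one_of_one_lt₀ hw).trans h.one_lt
  filter_upwards [hev, e4] with t h1 h2
  rw [hf _ h2, hf₁ _ h2] at h1
  linear_combination h1

theorem deriv_mul_comp_inv_ne_zero {g : ℂ → ℂ} {w : ℂ} {k : ℂ → ℂ} (hw : w ≠ 0)
    (hg : AnalyticAt ℂ g w⁻¹) (hg0 : g w⁻¹ = 0) (hg1 : deriv g w⁻¹ ≠ 0)
    (hk : AnalyticAt ℂ k w) (hk0 : k w ≠ 0) : deriv (fun t => k t * g t⁻¹) w ≠ 0 := by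
  have h1 : HasDerivAt (fun t => g t⁻¹) (deriv g w⁻¹ * -(w ^ 2)⁻¹) w :=
    hg.differentiableAt.hasDerivAt.comp w (hasDerivAt_inv hw)
  have h2 := hk.differentiableAt.hasDerivAt.mul h1
  have h3 : deriv (fun t => k t * g t⁻¹) w = _ := h2.deriv
  rw [h3, hg0]
  simp [hk0, hg1, hw]

theorem IsEntireMeromorphicJost.P_eq_strip (hu : J.IsEntireMeromorphicJost u)
    (hu₁ : J.strip.IsEntireMeromorphicJost u₁) (h : J.IsJostFamily R f) (hJ : J.GeometricDecay) :
    J.P u = J.strip.P u₁ := by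
  ext w
  rw [hu.mem_P_iff h hJ, hu₁.mem_P_iff h.strip hJ.strip]
  refine and_congr_right fun hw => ?_
  have hw0 : w ≠ 0 := norm_pos_iff.1 (one_pos.trans hw)
  have hs0 : w⁻¹ ≠ 0 := inv_ne_zero hw0
  have hs1 : ‖w⁻¹‖ < 1 := by rw [norm_inv]; exact inv_lt_one_of_one_lt₀ hw
  have hsR := hs1.trans h.one_lt
  have ha : (J.a 0 : ℂ) ≠ 0 := J.offDiag_ne_zero 1
  have hai := analyticAt_inv (𝕜 := ℂ) hw0
  have hcomp : ∀ n, AnalyticAt ℂ (fun t => f n t⁻¹) w := fun n => (h.analyticAt n hsR).comp hai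
  have hp : AnalyticAt ℂ (fun t => t * f 0 t⁻¹) w := analyticAt_id.mul (hcomp 0)
  have hq : AnalyticAt ℂ (fun t => J.a 0 * (t⁻¹ * f 1 t⁻¹)) w :=
    analyticAt_const.mul (hai.mul (hcomp 1))
  have hc : AnalyticAt ℂ (fun t : ℂ => (J.a 0 : ℂ) * (t - t⁻¹)) w :=
    analyticAt_const.mul (analyticAt_id.sub hai)
  have hrel := hu.eventually_relation hu₁ h hJ hw
  have hp1 : w * f 0 w⁻¹ = 0 → deriv (fun t => t * f 0 t⁻¹) w ≠ 0 := by
    intro e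
    have h0 := (mul_eq_zero.1 e).resolve_left hw0
    exact deriv_mul_comp_inv_ne_zero (k := fun t => t) hw0 (h.analyticAt 0 hsR) h0
      (h.deriv_ne_zero_of_zero hs0 hs1 h0) analyticAt_id hw0
  have hq1 : J.a 0 * (w⁻¹ * f 1 w⁻¹) = 0 → deriv (fun t => J.a 0 * (t⁻¹ * f 1 t⁻¹)) w ≠ 0 := by
    intro e
    have h0 : J.a 0 * f 1 w⁻¹ = 0 := by
      simpa [hw0] using e
    have h1 := deriv_mul_comp_inv_ne_zero (k := fun t => t⁻¹) hw0 (h.strip.analyticAt 0 hsR) h0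
      (h.strip.deriv_ne_zero_of_zero hs0 hs1 h0) hai hs0
    convert h1 using 3
    simp only [stripFamily]
    ring
  have hfwd := isPole_or_of_relation (hu.meromorphicNFAt w) (hu₁.meromorphicNFAt w) hp hq hc hrel
    hq1
  -- The roles of u and u₁ are exchanged, which turns c into -c.
  have hbwd := isPole_or_of_relation (c := fun t => -(J.a 0 * (t - t⁻¹)))
    (hu₁.meromorphicNFAt w) (hu.meromorphicNFAt w) hq hp hc.neg
    (hrel.mono fun t ht => by linear_combination -ht) hp1
  have hL : (IsPole u w ∨ f 0 w⁻¹ = 0 ∧ ¬ IsPole u w ∧ w - w⁻¹ + u w * (w⁻¹ * f 1 w⁻¹) ≠ 0) ↔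
      (IsPole u w ∨ w * f 0 w⁻¹ = 0 ∧ ¬ IsPole u w ∧
        J.a 0 * (w - w⁻¹) + J.a 0 * (w⁻¹ * f 1 w⁻¹) * u w ≠ 0) := by
    have e : J.a 0 * (w - w⁻¹) + J.a 0 * (w⁻¹ * f 1 w⁻¹) * u w =
      J.a 0 * (w - w⁻¹ + u w * (w⁻¹ * f 1 w⁻¹)) := by ring
    rw [e, mul_ne_zero_iff, mul_eq_zero]
    simp only [hw0, ha, false_or, ne_eq, not_false_eq_true, true_and]
  have hR : (IsPole u₁ w ∨ J.stripFamily f 0 w⁻¹ = 0 ∧ ¬ IsPole u₁ w ∧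
        w - w⁻¹ + u₁ w * (w⁻¹ * J.stripFamily f 1 w⁻¹) ≠ 0) ↔
      (IsPole u₁ w ∨ J.a 0 * (w⁻¹ * f 1 w⁻¹) = 0 ∧ ¬ IsPole u₁ w ∧
        w * f 0 w⁻¹ * u₁ w - J.a 0 * (w - w⁻¹) ≠ 0) := by
    refine or_congr_right ?_
    have e0 : J.stripFamily f 0 w⁻¹ = J.a 0 * f 1 w⁻¹ := rfl
    have e1 : J.stripFamily f 1 w⁻¹ = f 2 w⁻¹ := rfl
    rw [e0, e1]
    have e2 : J.a 0 * f 1 w⁻¹ = 0 ↔ J.a 0 * (w⁻¹ * f 1 w⁻¹) = 0 := by simp [ha, hw0]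
    rw [← e2]
    refine and_congr_right fun h1 => and_congr_right fun _ => ?_
    have h1' := (mul_eq_zero.1 h1).resolve_left ha
    -- Where f_1 vanishes this says f_0 = -a_1 w⁻² f_2, turning the condition of J^{(1)}, stated
    -- with f_2, into one on p u₁ - c.
    have hrec := h.recurrence 0 w⁻¹ (by simpa using hsR)
    simp only [offDiag, h1', zero_add, mul_zero, zero_sub, Complex.ofReal_one, one_mul] at hrec
    have e3 : w * f 0 w⁻¹ * u₁ w - J.a 0 * (w - w⁻¹) =
        -J.a 0 * (w - w⁻¹ + u₁ w * (w⁻¹ * f 2 w⁻¹)) := by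
      rw [hrec]; field_simp; ring
    rw [e3, mul_ne_zero_iff]
    simp [ha]
  rw [hL, hR]
  constructor
  · exact hfwd
  · intro H
    have := hbwd (by simpa only [sub_eq_add_neg, add_comm] using H)
    simpa only [sub_neg_eq_add, add_comm] using this

theorem IsEntireMeromorphicJost.exists_strip (hu : J.IsEntireMeromorphicJost u)
    (h : J.IsJostFamily R f) (hJ : J.GeometricDecay) :
    ∃ u₁, J.strip.IsEntireMeromorphicJost u₁ := by
  classical
  set Φ : ℂ → ℂ := fun t => J.a 0 * (t - t⁻¹ + u t * (t⁻¹ * f 1 t⁻¹)) / (t * f 0 t⁻¹) with hΦ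
  -- The known function on |t| < R is glued to the solution of p u₁ = c + q u outside. The Wronskian
  -- identity makes them agree on 1 < |t| < R wherever f_0(1/t) ≠ 0, so V is meromorphic also at |t|
  -- = R.
  set V : ℂ → ℂ := fun t => if ‖t‖ < R then J.a 0 * f 1 t else Φ t with hV
  have hin : ∀ t, ‖t‖ < R → V =ᶠ[𝓝 t] J.stripFamily f 0 := by
    intro t ht
    filter_upwards [continuous_norm.continuousAt.eventually_lt_const ht] with ζ hζ
    exact if_pos hζ
  have hmer : MeromorphicOn V Set.univ := by
    intro t _
    by_cases ht : ‖t‖ < R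
    · exact ((h.strip.analyticAt 0 ht).congr (hin t ht).symm).meromorphicAt
    have ht1 : 1 < ‖t‖ := h.one_lt.trans_le (not_lt.1 ht)
    have ht0 : t ≠ 0 := norm_pos_iff.1 (one_pos.trans ht1)
    have hs0 : t⁻¹ ≠ 0 := inv_ne_zero ht0
    have hs1 : ‖t⁻¹‖ < 1 := by rw [norm_inv]; exact inv_lt_one_of_one_lt₀ ht1
    have hsR := hs1.trans h.one_lt
    have hai := analyticAt_inv (𝕜 := ℂ) ht0
    have hcomp : ∀ n, AnalyticAt ℂ (fun t => f n t⁻¹) t := fun n => (h.analyticAt n hsR).comp hai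
    have hΦm : MeromorphicAt Φ t := by
      have hum := (hu.meromorphicNFAt t).meromorphicAt
      have h1 : MeromorphicAt (fun t => t - t⁻¹ + u t * (t⁻¹ * f 1 t⁻¹)) t :=
        (analyticAt_id.sub hai).meromorphicAt.add (hum.mul (hai.mul (hcomp 1)).meromorphicAt)
      exact (analyticAt_const.meromorphicAt.mul h1).div
        (analyticAt_id.mul (hcomp 0)).meromorphicAt
    refine hΦm.congr ?_
    have hinv : Tendsto (fun ζ : ℂ => ζ⁻¹) (𝓝[≠] t) (𝓝[≠] t⁻¹) := by
      refine tendsto_nhdsWithin_iff.2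
        ⟨(continuousAt_inv₀ ht0).tendsto.mono_left nhdsWithin_le_nhds, ?_⟩
      filter_upwards [self_mem_nhdsWithin] with ζ hζ
      simpa using hζ
    have e1 := hinv.eventually (h.eventually_ne_zero hs0 hs1)
    have e2 : ∀ᶠ ζ : ℂ in 𝓝[≠] t, 1 < ‖ζ‖ :=
      (continuous_norm.continuousAt.eventually_const_lt ht1).filter_mono nhdsWithin_le_nhds
    filter_upwards [e1, e2] with ζ h1 h2
    by_cases hζ : ‖ζ‖ < R
    · have hζ0 : ζ ≠ 0 := norm_pos_iff.1 (one_pos.trans h2)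
      have hζi : ‖ζ⁻¹‖ < R := by
        rw [norm_inv]; exact (inv_lt_one_of_one_lt₀ h2).trans h.one_lt
      have := h.mul_sub_mul_inv hJ hζ0 hζ hζi
      rw [hV]
      simp only [if_pos hζ, hΦ]
      rw [div_eq_iff (mul_ne_zero hζ0 h1), hu.eq_family h ζ hζ]
      linear_combination -(J.a 0 : ℂ) * this
    · exact (if_neg hζ).symm
  refine ⟨toMeromorphicNFOn V Set.univ, meromorphicNFOn_toMeromorphicNFOn V Set.univ,
    fun z hz hz1 => ⟨_, h.strip.isJostSolution (norm_pos_iff.1 hz) hz1, ?_⟩⟩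
  have hzR := hz1.trans h.one_lt
  have hVa : AnalyticAt ℂ V z := (h.strip.analyticAt 0 hzR).congr (hin z hzR).symm
  rw [toMeromorphicNFOn_eq_toMeromorphicNFAt hmer (Set.mem_univ z),
    toMeromorphicNFAt_eq_self.2 hVa.meromorphicNFAt, (hin z hzR).self_of_nhds]
  simp

end JacobiMatrix

end

theorem theorem4p1 (J : JacobiMatrix) (hJ : J.ExpDecay) (u : ℂ → ℂ)
    (hu : J.IsEntireMeromorphicJost u) :
    (∃ u₁ : ℂ → ℂ, J.strip.IsEntireMeromorphicJost u₁) ∧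
      ∀ u₁ : ℂ → ℂ, J.strip.IsEntireMeromorphicJost u₁ → J.P u = J.strip.P u₁ := by
  have hd := hJ.geometricDecay
  obtain ⟨R, f, hf⟩ := hd.exists_isJostFamily
  exact ⟨hu.exists_strip hf hd, fun u₁ hu₁ => hu.P_eq_strip hu₁ hf hd⟩
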